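/- Let $w:[0,1]^2\to[0,\infty)$ be measurable and symmetric with $\int_0^1\!\int_0^1 w(u,v)\,du\,dv=1$, let $m\ge 1$, and let $\rho_n>0$. Put $w_n(u,v)=w(u,v)\,1\{w(u,v)\le\rho_n^{-1}\}$ and $h_n=\rho_n w_n$, and suppose that $w_n\to w$ in $L_2([0,1]^2)$ (this holds, for instance, if $\rho_n w\le 1$ for all $n$, or if $\rho_n\to 0$ and the moment condition below holds). For each $n$, let $G_n$ be a random simple undirected graph on the vertices $1,\dots,n$, with adjacency matrix $A$, generated as follows: $\xi_1,\dots,\xi_n$ are i.i.d. uniform on $(0,1)$ and, conditionally on $\xi_1,\dots,\xi_n$, the edges are independent with $\mathbb P(A_{ij}=1\mid \xi_1,\dots,\xi_n)=h_n(\xi_i,\xi_j)$ for $i<j$. Let $D_i$ be the degree of $i$, $\bar D=\frac1n\sum_{i=1}^n D_i$, and let $D_i^{(k)}$ be the number of paths of length $k$ with pairwise distinct vertices that start at $i$, that is, the number of sequences $(i,i_1,\dots,i_k)$ of distinct vertices whose consecutive members are adjacent (so $D_i^{(1)}=D_i$). Let $\mathbf D_i^{(m)}=\bigl(D_i/\bar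 D,\,D_i^{(2)}/\bar D^2,\dots,D_i^{(m)}/\bar D^m\bigr)$ (set to $0$ if $\bar D=0$) and let $\hat F_m$ be the empirical distribution of $\mathbf D_1^{(m)},\dots,\mathbf D_n^{(m)}$. Let $[T_wf](u)=\int_0^1 w(u,v)f(v)\,dv$, $\tau_w(u)=\int_0^1w(u,v)\,dv$ and $\boldsymbol\theta_m(u)=\bigl(\tau_w(u),[T_w\tau_w](u),\dots,[T_w^{m-1}\tau_w](u)\bigr)$, and let $F_m$ be the distribution of $\boldsymbol\theta_m(\xi)$ with $\xi$ uniform on $(0,1)$. The Mallows 2-distance $M_2(P,Q)$ is the infimum of $(\mathbb E\|X-Y\|^2)^{1/2}$ over all couplings $(X,Y)$ of $P$ and $Q$. Suppose that $\lambda_n=(n-1)\rho_n\to\infty$ and $\int_0^1\!\int_0^1 w(u,v)^{2m}\,du\,dv<\infty$. Then $M_2(\hat F_m,F_m)\to 0$ in probability as $n\to\infty$. Moreover, if $\hat G_m$ is the empirical distribution of the pairs $(\mathbf D_i^{(m)},\boldsymbol\theta_m(\xi_i))$, $i=1,\dots,n$, then $$\int\|\mathbf x-\mathbf y\|^2\,d\hat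 G_m(\mathbf x,\mathbf y)=\frac1n\sum_{i=1}^n\bigl\|\mathbf D_i^{(m)}-\boldsymbol\theta_m(\xi_i)\bigr\|^2\to 0\quad\text{in probability.}$$ (No monotonicity of $\tau_w$ is assumed; the result applies in particular to the canonical $w$, the version for which $\tau_w$ is nondecreasing.) -/

import Mathlib

open MeasureTheory ProbabilityTheory Filter Topology
open scoped ENNReal unitInterval

noncomputable section

namespace LatentGraph

/-- The truncated kernel `w · 1(w ≤ ρ⁻¹)`. -/
def truncKernel (w : I → I → ℝ) (ρ : ℝ) (u v : I) : ℝ :=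
  open Classical in if w u v ≤ ρ⁻¹ then w u v else 0

/-- The edge probability `h(u, v) = ρ w(u, v) 1(w(u, v) ≤ ρ⁻¹)`. -/
def edgeProb (w : I → I → ℝ) (ρ : ℝ) (u v : I) : ℝ :=
  ρ * truncKernel w ρ u v

/-- Probability of the graph `H` when the edges are independent and the pair `i, j` is joined
with probability `h (x i) (x j)`. -/
def graphProb {n : ℕ} (h : I → I → ℝ) (x : Fin n → I) (H : SimpleGraph (Fin n)) : ℝ :=
  open Classical in
  ∏ p : Fin n × Fin n with p.1 < p.2,
    if H.Adj p.1 p.2 then h (x p.1) (x p.2) else 1 - h (x p.1) (x p.2)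

/-- The random graph `G` on `n` vertices is generated by the latent variables `ξ`: these are
i.i.d. uniform on the unit interval and, conditionally on them, the edges of `G` are independent
with `P(A i j = 1 | ξ) = h (ξ i) (ξ j)`. -/
structure IsLatentGraph {Ω : Type*} [MeasurableSpace Ω] (μ : Measure Ω) {n : ℕ}
    (h : I → I → ℝ) (ξ : Fin n → Ω → I) (G : Ω → SimpleGraph (Fin n)) : Prop where
  measurable_latent : ∀ i, Measurable (ξ i)
  indep_latent : iIndepFun ξ μ
  uniform_latent : ∀ i, μ.map (ξ i) = volume
  measurableSet_adj : ∀ i j, MeasurableSet {ω | (G ω).Adj i j}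
  conditional_law : ∀ (H : SimpleGraph (Fin n)) (B : Set (Fin n → I)), MeasurableSet B →
    μ {ω | (fun i => ξ i ω) ∈ B ∧ G ω = H} =
      ∫⁻ ω in {ω | (fun i => ξ i ω) ∈ B}, ENNReal.ofReal (graphProb h (fun i => ξ i ω) H) ∂μ

/-- The average degree `D̄`. -/
def avgDegree {n : ℕ} (G : SimpleGraph (Fin n)) : ℝ :=
  open Classical in (∑ i, (G.degree i : ℝ)) / n

/-- The `k`-degree `D_i^(k)`: the number of sequences `i = p 0, p 1, …, p k` of distinct vertices
in which consecutive vertices are adjacent. -/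
def pathDegree {n : ℕ} (G : SimpleGraph (Fin n)) (k : ℕ) (i : Fin n) : ℕ :=
  open Classical in
  Finset.card {p : Fin (k + 1) → Fin n |
    Function.Injective p ∧ p 0 = i ∧ ∀ j : Fin k, G.Adj (p j.castSucc) (p j.succ)}

/-- The normalized vector `(D_i / D̄, D_i^(2) / D̄ ^ 2, …, D_i^(m) / D̄ ^ m)`. -/
def degreeVec {n : ℕ} (m : ℕ) (G : SimpleGraph (Fin n)) (i : Fin n) :
    EuclideanSpace ℝ (Fin m) :=
  WithLp.toLp 2 fun k => (pathDegree G (k + 1) i : ℝ) / avgDegree G ^ ((k : ℕ) + 1)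

/-- The integral operator `T_w`. -/
def kernelOp (w : I → I → ℝ) (f : I → ℝ) (u : I) : ℝ :=
  ∫ v, w u v * f v

/-- The function `τ_w(u) = ∫ w(u, v) dv`. -/
def tau (w : I → I → ℝ) (u : I) : ℝ :=
  ∫ v, w u v

/-- The vector `θ_m(u) = (τ_w(u), (T_w τ_w)(u), …, (T_w^(m-1) τ_w)(u))`. -/
def theta (m : ℕ) (w : I → I → ℝ) (u : I) : EuclideanSpace ℝ (Fin m) :=
  WithLp.toLp 2 fun k => ((kernelOp w)^[k] (tau w)) u

/-- The empirical distribution of the points `x 0, …, x (n - 1)`. -/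
def empirical {E : Type*} [MeasurableSpace E] {n : ℕ} (x : Fin n → E) : Measure E :=
  (n : ℝ≥0∞)⁻¹ • ∑ i, Measure.dirac (x i)

/-- The Mallows 2-distance: the infimum of `(𝔼 ‖X - Y‖²) ^ (1/2)` over all couplings of `P`
and `Q`. -/
def mallows {E : Type*} [MeasurableSpace E] [NormedAddCommGroup E] (P Q : Measure E) : ℝ≥0∞ :=
  ⨅ (γ : Measure (E × E)) (_ : γ.map Prod.fst = P) (_ : γ.map Prod.snd = Q),
    (∫⁻ z, ‖z.1 - z.2‖ₑ ^ 2 ∂γ) ^ (1 / 2 : ℝ)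

end LatentGraph

end

/-! Write `T` for the integral operator with kernel `w`, so that the `k`-th coordinate of `θ_m` is
`T ^ k 1`, for `k = 1, …, m`. Given `ξ i`, a fixed path of length `k` from `i` is present with
probability `ρ ^ k` times the truncated analogue of `T ^ k 1 (ξ i)`. Two paths from `i` that share
no other vertex are conditionally independent given `ξ i`, so only overlapping pairs contribute to
the mean square deviation of `D_i^(k)` from its conditional mean. An overlap costs a free vertex but
saves only an edge; after division by `λ ^ (2 * k)`, with `λ = (n - 1) ρ`, the overlapping pairs
contribute `O(1 / λ)` (`sum_overlap_le`, `integral_pathDegree_sub_sq_le`).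

The moment of order `2 * m` enters because `T` is self-adjoint: `∫ (T ^ k 1) ^ 2 = ∫ T ^ (2 * k) 1`
is an integral of a product of `2 * k` edge weights. The same moment gives a dominating function for
removing the truncation (`tendsto_lintegral_lpath_sub_sq`). Hence `D_i^(k) / λ ^ k` is close to `T ^
k 1 (ξ i)` in mean square, uniformly in `i`. The case `k = 1` and the law of large numbers give `D̄
/ λ → 1`, and `λ` can be replaced by `D̄` (`vanish_average_normalized`). Summation over `k` yields
the second claim.

For the Mallows distance, `θ_m` is approximated in `L²` by a simple function `s`, whose finitely
many values serve as labels. By the law of large numbers the label frequencies of the sample are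
close to their probabilities, so a coupling of the uniform law on the indices with the uniform law
on `I` can match labels with high probability (`exists_coupling_labels`). Its image couples the
empirical law with the law of `θ_m`, and the cost is controlled by the mean square error, the
approximation error and the bounded cost of a mismatch (`mallows_empirical_le`). -/

namespace LatentGraph

/-! ### Coupling two measures so that finite labels agree as often as possible -/

section Coupling

variable {X Y K : Type*} [MeasurableSpace X] [MeasurableSpace Y] [Fintype K]

/-- The part of `P` that cannot be matched, label by label, with a measure giving mass `q k` to
the label `k`. -/
noncomputable def residual (P : Measure X) (f : X → K) (q : K → ℝ≥0∞) : Measure X :=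
  ∑ k, (1 - min (P (f ⁻¹' {k})) (q k) / P (f ⁻¹' {k})) • P.restrict (f ⁻¹' {k})

lemma residual_univ (P : Measure X) [IsProbabilityMeasure P] {f : X → K} (q : K → ℝ≥0∞) :
    residual P f q Set.univ = ∑ k, (P (f ⁻¹' {k}) - min (P (f ⁻¹' {k})) (q k)) := by
  simp only [residual, Measure.coe_finsetSum, Finset.sum_apply, Measure.smul_apply,
    Measure.restrict_apply_univ, smul_eq_mul]
  refine Finset.sum_congr rfl fun k _ => ?_
  rw [ENNReal.sub_mul (fun _ _ => measure_ne_top _ _), one_mul]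
  by_cases h : P (f ⁻¹' {k}) = 0
  · simp [h]
  · rw [ENNReal.div_mul_cancel h (measure_ne_top _ _)]

variable [MeasurableSpace K] [MeasurableSingletonClass K]

lemma sum_measure_inter_preimage (P : Measure X) {f : X → K} (hf : Measurable f) (s : Set X) :
    ∑ k, P (s ∩ f ⁻¹' {k}) = P s := by
  have h := sum_measure_preimage_singleton (μ := P.restrict s) (f := f) Finset.univ
    (fun y _ => hf (measurableSet_singleton y))
  simp only [Finset.coe_univ, Set.preimage_univ, Measure.restrict_apply_univ] at h
  rw [← h]
  refine Finset.sum_congr rfl fun k _ => ?_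
  rw [Measure.restrict_apply (hf (measurableSet_singleton k)), Set.inter_comm]

/-- This is the first-marginal computation for the coupling below. On label `k` with masses `p` and
`q`, the matched part carries the fraction `min p q / p` of `P` and the residual carries the rest.
The degenerate cases `p = 0`, `q = 0` and `δ = 0` are consistent because the accompanying measures
vanish and `∞ * 0 = 0`. -/
lemma matched_add_residual (P : Measure X) [IsProbabilityMeasure P] {f : X → K}
    (hf : Measurable f) (q : K → ℝ≥0∞) (hq : ∀ k, q k ≠ ∞) {δ : ℝ≥0∞}
    (hδ : residual P f q Set.univ = δ) {s : Set X} (hs : MeasurableSet s) :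
    ∑ k, min (P (f ⁻¹' {k})) (q k) / (P (f ⁻¹' {k}) * q k) * (P (s ∩ f ⁻¹' {k}) * q k)
      + δ⁻¹ * (residual P f q s * δ) = P s := by
  have h1 : δ⁻¹ * (residual P f q s * δ) = residual P f q s := by
    have hδ' : δ ≠ ∞ := by
      rw [← hδ, residual_univ]
      exact ENNReal.sum_ne_top.2 fun k _ => ENNReal.sub_ne_top (measure_ne_top _ _)
    by_cases h0 : δ = 0
    · have : residual P f q s = 0 := measure_mono_null (Set.subset_univ _) (hδ.trans h0)
      simp [this]
    · rw [mul_comm (residual P f q s), ← mul_assoc, ENNReal.inv_mul_cancel h0 hδ', one_mul]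
  rw [h1]
  simp only [residual, Measure.coe_finsetSum, Finset.sum_apply, Measure.smul_apply,
    Measure.restrict_apply hs, smul_eq_mul]
  rw [← Finset.sum_add_distrib, ← sum_measure_inter_preimage P hf s]
  refine Finset.sum_congr rfl fun k _ => ?_
  have hle : P (s ∩ f ⁻¹' {k}) ≤ P (f ⁻¹' {k}) := measure_mono Set.inter_subset_right
  have hpt : P (f ⁻¹' {k}) ≠ ∞ := measure_ne_top _ _
  by_cases hp : P (f ⁻¹' {k}) = 0
  · have : P (s ∩ f ⁻¹' {k}) = 0 := le_antisymm (hp ▸ hle) bot_le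
    simp [this]
  · have h2 : min (P (f ⁻¹' {k})) (q k) / (P (f ⁻¹' {k}) * q k) * (P (s ∩ f ⁻¹' {k}) * q k)
        = min (P (f ⁻¹' {k})) (q k) / P (f ⁻¹' {k}) * P (s ∩ f ⁻¹' {k}) := by
      by_cases hq0 : q k = 0
      · simp [hq0]
      · rw [div_eq_mul_inv, div_eq_mul_inv, ENNReal.mul_inv (Or.inl hp) (Or.inl hpt)]
        calc _ = min (P (f ⁻¹' {k})) (q k) * (P (f ⁻¹' {k}))⁻¹ * P (s ∩ f ⁻¹' {k})
              * ((q k)⁻¹ * q k) := by ring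
          _ = _ := by rw [ENNReal.inv_mul_cancel hq0 (hq k), mul_one]
    rw [h2, ← add_mul, add_tsub_cancel_of_le, one_mul]
    exact ENNReal.div_le_of_le_mul (by simp)

/-- Two probability measures carrying finitely many labels have a coupling under which the labels
differ with probability at most the total variation distance of the label distributions. -/
theorem exists_coupling_labels (P : Measure X) (Q : Measure Y) [IsProbabilityMeasure P]
    [IsProbabilityMeasure Q] {f : X → K} {g : Y → K} (hf : Measurable f) (hg : Measurable g) :
    ∃ γ : Measure (X × Y), γ.map Prod.fst = P ∧ γ.map Prod.snd = Q ∧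
      γ {z | f z.1 ≠ g z.2} ≤ ∑ k, (P (f ⁻¹' {k}) - Q (g ⁻¹' {k})) := by
  set p : K → ℝ≥0∞ := fun k => P (f ⁻¹' {k}) with hp
  set q : K → ℝ≥0∞ := fun k => Q (g ⁻¹' {k}) with hq
  have hp1 : ∑ k, p k = 1 := by
    simpa using sum_measure_inter_preimage P hf Set.univ
  have hq1 : ∑ k, q k = 1 := by
    simpa using sum_measure_inter_preimage Q hg Set.univ
  set δ : ℝ≥0∞ := residual P f q Set.univ with hδ
  have hδP : δ = ∑ k, (p k - min (p k) (q k)) := residual_univ P q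
  have hmin : ∑ k, min (p k) (q k) ≠ ∞ :=
    ENNReal.sum_ne_top.2 fun k _ => ne_top_of_le_ne_top (measure_ne_top P _) (min_le_left _ _)
  -- The two residuals have equal mass: each becomes `1` when the common matched mass `∑ min` is
  -- added.
  have hδQ : residual Q g p Set.univ = δ := by
    rw [hδP, residual_univ]
    refine (ENNReal.add_left_inj hmin).1 ?_
    rw [← Finset.sum_add_distrib, ← Finset.sum_add_distrib]
    have h1 : ∀ k, q k - min (q k) (p k) + min (p k) (q k) = q k := fun k => by
      rw [min_comm (p k), tsub_add_cancel_of_le (min_le_left _ _)]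
    have h2 : ∀ k, p k - min (p k) (q k) + min (p k) (q k) = p k := fun k => by
      rw [tsub_add_cancel_of_le (min_le_left _ _)]
    exact (Finset.sum_congr rfl fun k _ => h1 k).trans
      (hq1.trans (hp1.symm.trans (Finset.sum_congr rfl fun k _ => (h2 k).symm)))
  have hδt : δ ≠ ∞ := by
    rw [hδP]; exact ENNReal.sum_ne_top.2 fun k _ => ENNReal.sub_ne_top (measure_ne_top _ _)
  have : IsFiniteMeasure (residual Q g p) := ⟨by rw [hδQ]; exact hδt.lt_top⟩
  have : IsFiniteMeasure (residual P f q) := ⟨by rw [← hδ]; exact hδt.lt_top⟩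
  -- Within each label, mass `min (p k) (q k)` is coupled independently; the two residuals of mass
  -- `δ` are coupled independently of the labels. Labels can differ only in the last term, of mass
  -- at most `δ`.
  refine ⟨∑ k, (min (p k) (q k) / (p k * q k)) •
      ((P.restrict (f ⁻¹' {k})).prod (Q.restrict (g ⁻¹' {k}))) +
      δ⁻¹ • ((residual P f q).prod (residual Q g p)), ?_, ?_, ?_⟩
  · ext s hs
    rw [Measure.map_apply measurable_fst hs, ← Set.prod_univ]
    simp only [Measure.add_apply, Measure.coe_finsetSum, Finset.sum_apply, Measure.smul_apply,
      smul_eq_mul, Measure.prod_prod, Measure.restrict_apply_univ, Measure.restrict_apply hs, hδQ]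
    exact matched_add_residual P hf q (fun k => measure_ne_top _ _) rfl hs
  · ext s hs
    rw [Measure.map_apply measurable_snd hs, ← Set.univ_prod]
    simp only [Measure.add_apply, Measure.coe_finsetSum, Finset.sum_apply, Measure.smul_apply,
      smul_eq_mul, Measure.prod_prod, Measure.restrict_apply_univ, Measure.restrict_apply hs]
    rw [← matched_add_residual Q hg p (fun k => measure_ne_top _ _) hδQ hs]
    congr 1
    · refine Finset.sum_congr rfl fun k _ => ?_
      rw [min_comm, mul_comm (p k) (q k), mul_comm (P _)]
    · rw [mul_comm (residual Q g p s)]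
  · have hz : ∀ k, ((P.restrict (f ⁻¹' {k})).prod (Q.restrict (g ⁻¹' {k})))
        {z | f z.1 ≠ g z.2} = 0 := by
      intro k
      rw [Measure.prod_restrict]
      have hm : MeasurableSet ((f ⁻¹' {k}) ×ˢ (g ⁻¹' {k})) :=
        (hf (measurableSet_singleton k)).prod (hg (measurableSet_singleton k))
      rw [Measure.restrict_apply' hm]
      convert measure_empty (μ := P.prod Q)
      ext z
      simp only [Set.mem_inter_iff, Set.mem_ofPred_eq, Set.mem_prod, Set.mem_preimage,
        Set.mem_singleton_iff, Set.mem_empty_iff_false, iff_false, not_and]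
      grind
    simp only [Measure.add_apply, Measure.coe_finsetSum, Finset.sum_apply, Measure.smul_apply,
      smul_eq_mul, hz, mul_zero, Finset.sum_const_zero, zero_add]
    calc δ⁻¹ * ((residual P f q).prod (residual Q g p)) {z | f z.1 ≠ g z.2}
        ≤ δ⁻¹ * (δ * δ) := by
          gcongr
          refine (measure_mono (Set.subset_univ _)).trans ?_
          rw [← Set.univ_prod_univ, Measure.prod_prod, hδQ]
      _ ≤ δ := by
          rw [← mul_assoc]
          exact (mul_le_mul_left (ENNReal.inv_mul_le_one δ) δ).trans (one_mul δ).le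
      _ = _ := by
          rw [hδP]
          exact Finset.sum_congr rfl fun k _ => tsub_min

end Coupling

/-! ### Iterated kernels with values in `[0, ∞]` and path integrals -/

section Kernel

variable {α : Type*} [MeasurableSpace α] {ν : Measure α}

lemma measurable_kernel_comp {β δ : Type*} [MeasurableSpace β] [MeasurableSpace δ]
    {K : α → α → β} (hK : Measurable (Function.uncurry K)) {f g : δ → α} (hf : Measurable f)
    (hg : Measurable g) : Measurable fun x => K (f x) (g x) :=
  Measurable.comp (g := Function.uncurry K) (f := fun x => (f x, g x)) hK (hf.prodMk hg)

/-- The integral operator with kernel `K` on functions with values in `[0, ∞]`. -/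
noncomputable def lkernelOp (ν : Measure α) (K : α → α → ℝ≥0∞) (f : α → ℝ≥0∞) (u : α) : ℝ≥0∞ :=
  ∫⁻ v, K u v * f v ∂ν

/-- The function `T ^ k 1`. -/
noncomputable def lpath (ν : Measure α) (K : α → α → ℝ≥0∞) (k : ℕ) : α → ℝ≥0∞ :=
  (lkernelOp ν K)^[k] 1

lemma lpath_zero (K : α → α → ℝ≥0∞) : lpath ν K 0 = 1 := rfl

lemma lpath_succ (K : α → α → ℝ≥0∞) (k : ℕ) :
    lpath ν K (k + 1) = lkernelOp ν K (lpath ν K k) :=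
  Function.iterate_succ_apply' _ _ _

lemma measurable_lkernelOp [SFinite ν] {K : α → α → ℝ≥0∞} (hK : Measurable (Function.uncurry K))
    {f : α → ℝ≥0∞} (hf : Measurable f) : Measurable (lkernelOp ν K f) :=
  Measurable.lintegral_prod_right' (f := fun z : α × α => K z.1 z.2 * f z.2)
    (hK.mul (hf.comp measurable_snd))

lemma measurable_lpath [SFinite ν] {K : α → α → ℝ≥0∞} (hK : Measurable (Function.uncurry K))
    (k : ℕ) : Measurable (lpath ν K k) := by
  induction k with
  | zero => exact measurable_one
  | succ k ih => rw [lpath_succ]; exact measurable_lkernelOp hK ih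

lemma lpath_const_mul {K : α → α → ℝ≥0∞} {c : ℝ≥0∞} (hc : c ≠ ∞) (k : ℕ) (u : α) :
    lpath ν (fun u v => c * K u v) k u = c ^ k * lpath ν K k u := by
  induction k generalizing u with
  | zero => simp [lpath_zero]
  | succ k ih =>
    rw [lpath_succ, lpath_succ]
    simp only [lkernelOp, ih]
    rw [← lintegral_const_mul' _ _ (ENNReal.pow_ne_top hc)]
    refine lintegral_congr fun v => ?_
    ring

lemma lpath_mono {K L : α → α → ℝ≥0∞} (h : ∀ u v, K u v ≤ L u v) (k : ℕ) (u : α) :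
    lpath ν K k u ≤ lpath ν L k u := by
  induction k generalizing u with
  | zero => exact le_rfl
  | succ k ih =>
    rw [lpath_succ, lpath_succ]
    exact lintegral_mono fun v => mul_le_mul' (h u v) (ih v)

lemma lpath_le_one [IsProbabilityMeasure ν] {K : α → α → ℝ≥0∞} (h : ∀ u v, K u v ≤ 1) (k : ℕ)
    (u : α) : lpath ν K k u ≤ 1 := by
  induction k generalizing u with
  | zero => exact le_rfl
  | succ k ih =>
    rw [lpath_succ]
    calc lkernelOp ν K (lpath ν K k) u ≤ ∫⁻ _, 1 ∂ν :=
          lintegral_mono fun v => mul_le_one' (h u v) (ih v)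
      _ = 1 := by simp

lemma lintegral_mul_lkernelOp [SFinite ν] {K : α → α → ℝ≥0∞}
    (hK : Measurable (Function.uncurry K)) (hsymm : ∀ u v, K u v = K v u) {f g : α → ℝ≥0∞}
    (hf : Measurable f) (hg : Measurable g) :
    ∫⁻ u, f u * lkernelOp ν K g u ∂ν = ∫⁻ u, lkernelOp ν K f u * g u ∂ν := by
  have h1 : ∀ u, f u * lkernelOp ν K g u = ∫⁻ v, f u * (K u v * g v) ∂ν := fun u =>
    (lintegral_const_mul _ ((hK.comp measurable_prodMk_left).mul hg)).symm
  have h2 : ∀ v, lkernelOp ν K f v * g v = ∫⁻ u, f u * (K u v * g v) ∂ν := fun v => by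
    have hm : Measurable fun u => K v u * f u :=
      (measurable_kernel_comp hK measurable_const measurable_id).mul hf
    refine (lintegral_mul_const (g v) hm).symm.trans (lintegral_congr fun u => ?_)
    rw [hsymm v u]; ring
  simp_rw [h1, h2]
  refine lintegral_lintegral_swap (Measurable.aemeasurable ?_)
  exact (hf.comp measurable_fst).mul (hK.mul (hg.comp measurable_snd))

/-- Self-adjointness moves the operators one at a time from one factor to the other.
Probabilistically, two paths issued from a common point are joined into one path. -/
lemma lintegral_lpath_mul_lpath [SFinite ν] {K : α → α → ℝ≥0∞}
    (hK : Measurable (Function.uncurry K)) (hsymm : ∀ u v, K u v = K v u) (j k : ℕ) :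
    ∫⁻ u, lpath ν K j u * lpath ν K k u ∂ν = ∫⁻ u, lpath ν K (j + k) u ∂ν := by
  induction j generalizing k with
  | zero => simp [lpath_zero]
  | succ j ih =>
    rw [lpath_succ, ← lintegral_mul_lkernelOp hK hsymm (measurable_lpath hK j)
      (measurable_lpath hK k), ← lpath_succ, ih, add_right_comm, add_assoc]

variable [IsProbabilityMeasure ν] {ι : Type*} [Fintype ι]

lemma lintegral_eval_pi {f : α → ℝ≥0∞} (hf : Measurable f) (i : ι) :
    ∫⁻ x, f (x i) ∂(Measure.pi fun _ : ι => ν) = ∫⁻ u, f u ∂ν :=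
  (measurePreserving_eval (fun _ : ι => ν) i).lintegral_comp hf

variable [DecidableEq ι]

/-- The inner vertices and the end of a path can be integrated out. -/
lemma lintegral_path {K : α → α → ℝ≥0∞} (hK : Measurable (Function.uncurry K)) (k : ℕ)
    {q : Fin (k + 1) → ι} (hq : Function.Injective q) {F : (ι → α) → ℝ≥0∞} (hF : Measurable F)
    (hFq : ∀ (j : Fin k) x t, F (Function.update x (q j.succ) t) = F x) {g : α → ℝ≥0∞}
    (hg : Measurable g) :
    ∫⁻ x, F x * ((∏ j : Fin k, K (x (q j.castSucc)) (x (q j.succ))) * g (x (q (Fin.last k))))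
        ∂(Measure.pi fun _ => ν)
      = ∫⁻ x, F x * ((lkernelOp ν K)^[k] g) (x (q 0)) ∂(Measure.pi fun _ => ν) := by
  have hKm : ∀ a b : ι, Measurable fun x : ι → α => K (x a) (x b) := fun a b =>
    measurable_kernel_comp hK (measurable_pi_apply a) (measurable_pi_apply b)
  induction k generalizing g with
  | zero => simp
  | succ k ih =>
    -- The path is shortened at its far end: integrating out the last vertex turns the end function
    -- `g` into `lkernelOp ν K g`.
    have hTg : Measurable (lkernelOp ν K g) := measurable_lkernelOp hK hg
    have hIH := ih (q := q ∘ Fin.castSucc) (hq.comp (Fin.castSucc_injective _))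
      (fun j x t => by simpa [← Fin.succ_castSucc] using hFq j.castSucc x t) hTg
    rw [Function.iterate_succ_apply]
    refine Eq.trans ?_ hIH
    have hprod : Measurable fun x : ι → α =>
        ∏ j : Fin k, K (x (q j.castSucc.castSucc)) (x (q j.succ.castSucc)) :=
      Finset.measurable_prod _ fun j _ => hKm _ _
    refine lintegral_eq_of_lmarginal_eq {q (Fin.last (k + 1))} ?_ ?_ ?_
    · exact hF.mul ((Finset.measurable_prod _ fun j _ => hKm _ _).mul
        (hg.comp (measurable_pi_apply _)))
    · exact hF.mul (hprod.mul (hTg.comp (measurable_pi_apply _)))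
    · rw [lmarginal_singleton, lmarginal_singleton]
      ext x
      have hF' : ∀ t, F (Function.update x (q (Fin.last (k + 1))) t) = F x := fun t => by
        simpa using hFq (Fin.last k) x t
      have hne : ∀ (j : Fin (k + 1)) t,
          Function.update x (q (Fin.last (k + 1))) t (q j.castSucc) = x (q j.castSucc) :=
        fun j t => Function.update_of_ne (fun h => (Fin.castSucc_ne_last j) (hq h)) _ _
      simp only [hF', Fin.prod_univ_castSucc, Function.comp_apply, hne, Fin.succ_castSucc,
        Fin.succ_last, Function.update_self, lintegral_const]
      have hm : Measurable fun v => K (x (q (Fin.last k).castSucc)) v * g v :=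
        (measurable_kernel_comp hK measurable_const measurable_id).mul hg
      rw [measure_univ, mul_one, lkernelOp, ← lintegral_const_mul _ hm,
        ← lintegral_const_mul _ (hm.const_mul _)]
      exact lintegral_congr fun v => by ring

lemma lintegral_edge_pi {K : α → α → ℝ≥0∞} (hK : Measurable (Function.uncurry K)) {a b : ι}
    (hab : a ≠ b) :
    ∫⁻ x, K (x a) (x b) ∂(Measure.pi fun _ : ι => ν) = ∫⁻ u, ∫⁻ v, K u v ∂ν ∂ν := by
  have hq : Function.Injective ![a, b] := by
    intro i j; fin_cases i <;> fin_cases j <;> simp [hab, hab.symm]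
  have h := lintegral_path (ν := ν) hK 1 hq (F := 1) measurable_one (fun _ _ _ => rfl) (g := 1)
    measurable_one
  simp only [Pi.one_apply, one_mul, mul_one, Fin.prod_univ_one, Function.iterate_one] at h
  refine Eq.trans h ((lintegral_eval_pi (measurable_lkernelOp hK measurable_one) a).trans ?_)
  simp [lkernelOp]

/-- A crude replacement for Hölder's inequality: the product is at most a power of its largest
factor, hence at most the sum of all such powers. -/
lemma prod_le_sum_pow {τ : Type*} {s : Finset τ} (hs : s.Nonempty) (f : τ → ℝ≥0∞) :
    ∏ t ∈ s, f t ≤ ∑ t ∈ s, f t ^ s.card := by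
  obtain ⟨t, ht, hmax⟩ := s.exists_max_image f hs
  calc ∏ t ∈ s, f t ≤ f t ^ s.card := Finset.prod_le_pow_card _ _ _ hmax
    _ ≤ _ := Finset.single_le_sum (f := fun t => f t ^ s.card) (fun _ _ => zero_le) ht

/-- After `prod_le_sum_pow` each term involves a single edge, so the way in which the edges meet is
irrelevant. This permits one bound for all overlap patterns of two paths. -/
lemma lintegral_prod_edges_le {τ : Type*} {s : Finset τ} (hs : s.Nonempty) {e : τ → ι × ι}
    (he : ∀ t ∈ s, (e t).1 ≠ (e t).2) {K : α → α → ℝ≥0∞} (hK : Measurable (Function.uncurry K)) :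
    ∫⁻ x, ∏ t ∈ s, K (x (e t).1) (x (e t).2) ∂(Measure.pi fun _ : ι => ν)
      ≤ s.card * ∫⁻ u, ∫⁻ v, K u v ^ s.card ∂ν ∂ν := by
  have hKs : Measurable (Function.uncurry fun u v => K u v ^ s.card) := hK.pow_const _
  calc _ ≤ ∫⁻ x, ∑ t ∈ s, K (x (e t).1) (x (e t).2) ^ s.card ∂(Measure.pi fun _ : ι => ν) :=
        lintegral_mono fun x => prod_le_sum_pow hs _
    _ = ∑ t ∈ s, ∫⁻ x, K (x (e t).1) (x (e t).2) ^ s.card ∂(Measure.pi fun _ : ι => ν) :=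
        lintegral_finsetSum _ fun t _ => (measurable_kernel_comp hK (measurable_pi_apply _)
          (measurable_pi_apply _)).pow_const _
    _ = ∑ t ∈ s, ∫⁻ u, ∫⁻ v, K u v ^ s.card ∂ν ∂ν :=
        Finset.sum_congr rfl fun t ht => lintegral_edge_pi hKs (he t ht)
    _ = _ := by rw [Finset.sum_const, nsmul_eq_mul]

lemma lintegral_kernel_pow_le (K : α → α → ℝ≥0∞) {k l : ℕ} (h : k ≤ l) :
    ∫⁻ u, ∫⁻ v, K u v ^ k ∂ν ∂ν ≤ 1 + ∫⁻ u, ∫⁻ v, K u v ^ l ∂ν ∂ν := by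
  calc ∫⁻ u, ∫⁻ v, K u v ^ k ∂ν ∂ν ≤ ∫⁻ u, ∫⁻ v, (1 + K u v ^ l) ∂ν ∂ν := by
        refine lintegral_mono fun u => lintegral_mono fun v => ?_
        rcases le_total (K u v) 1 with h1 | h1
        · exact (pow_le_one' h1 k).trans le_self_add
        · exact (pow_le_pow_right₀ h1 h).trans le_add_self
    _ = _ := by
        simp only [lintegral_add_left measurable_const, lintegral_const, measure_univ, mul_one]

lemma lintegral_lpath_le {K : α → α → ℝ≥0∞} (hK : Measurable (Function.uncurry K)) {k : ℕ}
    (hk : k ≠ 0) :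
    ∫⁻ u, lpath ν K k u ∂ν ≤ k * ∫⁻ u, ∫⁻ v, K u v ^ k ∂ν ∂ν := by
  have h := lintegral_path (ν := ν) hK k (q := id) Function.injective_id (F := 1) measurable_one
    (fun _ _ _ => rfl) (g := 1) measurable_one
  simp only [Pi.one_apply, one_mul, mul_one, id] at h
  rw [← lintegral_eval_pi (measurable_lpath hK k) (0 : Fin (k + 1)), lpath, ← h]
  have : Nonempty (Fin k) := ⟨⟨0, Nat.pos_of_ne_zero hk⟩⟩
  simpa using lintegral_prod_edges_le (ν := ν) (s := Finset.univ) Finset.univ_nonempty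
    (e := fun j : Fin k => (j.castSucc, j.succ)) (fun j _ => (Fin.castSucc_lt_succ).ne) hK

/-- A bound for the second moments of the functions `T ^ k 1`, `k ≤ m`. -/
noncomputable def momentBound (ν : Measure α) (K : α → α → ℝ≥0∞) (m : ℕ) : ℝ≥0∞ :=
  (2 * m) * (1 + ∫⁻ u, ∫⁻ v, K u v ^ (2 * m) ∂ν ∂ν)

/-- The square is the integral of a path with `k + k ≤ 2 * m` edges. The summand `1` in
`momentBound` absorbs the passage from a lower moment to the moment of order `2 * m`. -/
lemma lintegral_lpath_sq_le {K : α → α → ℝ≥0∞} (hK : Measurable (Function.uncurry K))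
    (hsymm : ∀ u v, K u v = K v u) {k m : ℕ} (hk : k ≠ 0) (hkm : k ≤ m) :
    ∫⁻ u, lpath ν K k u ^ 2 ∂ν ≤ momentBound ν K m := by
  simp_rw [sq]
  rw [lintegral_lpath_mul_lpath hK hsymm]
  refine (lintegral_lpath_le hK (by omega)).trans ?_
  rw [momentBound]
  refine mul_le_mul' ?_ (lintegral_kernel_pow_le K (by omega))
  have : k + k ≤ 2 * m := by omega
  exact_mod_cast this

lemma ae_lpath_ne_top {K : α → α → ℝ≥0∞} (hK : Measurable (Function.uncurry K))
    (hsymm : ∀ u v, K u v = K v u) {k m : ℕ} (hkm : k ≤ m) (hm : momentBound ν K m ≠ ∞) :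
    ∀ᵐ u ∂ν, lpath ν K k u ≠ ∞ := by
  rcases eq_or_ne k 0 with rfl | hk
  · simp [lpath_zero]
  · have h := ae_lt_top ((measurable_lpath (ν := ν) hK k).pow_const 2)
      (ne_top_of_le_ne_top hm (lintegral_lpath_sq_le hK hsymm hk hkm))
    filter_upwards [h] with u hu htop
    simp [htop] at hu

/-- Induction by dominated convergence. The dominating function `v ↦ K u v * lpath ν K k v` has
integral `lpath ν K (k + 1) u`, which is finite for almost every `u`. -/
lemma ae_tendsto_lpath {K : α → α → ℝ≥0∞} {L : ℕ → α → α → ℝ≥0∞} (hL : ∀ n, Measurable (Function.uncurry (L n)))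
    (hLK : ∀ n u v, L n u v ≤ K u v) (hfinK : ∀ u v, K u v ≠ ∞)
    (hconv : ∀ᵐ u ∂ν, ∀ᵐ v ∂ν, Tendsto (fun n => L n u v) atTop (𝓝 (K u v)))
    (k : ℕ) (hfin : ∀ j ≤ k, ∀ᵐ u ∂ν, lpath ν K j u ≠ ∞) :
    ∀ᵐ u ∂ν, Tendsto (fun n => lpath ν (L n) k u) atTop (𝓝 (lpath ν K k u)) := by
  induction k with
  | zero => simp [lpath_zero]
  | succ k ih =>
    filter_upwards [hfin (k + 1) le_rfl, hconv] with u hu hLu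
    simp only [lpath_succ] at hu ⊢
    refine tendsto_lintegral_of_dominated_convergence (fun v => K u v * lpath ν K k v)
      (fun n => (measurable_kernel_comp (hL n) measurable_const measurable_id).mul
        (measurable_lpath (hL n) k))
      (fun n => ae_of_all _ fun v => mul_le_mul' (hLK n u v) (lpath_mono (hLK n) k v)) hu ?_
    filter_upwards [hLu, ih fun j hj => hfin j (by omega), hfin k (by omega)] with v h1 h2 h3
    exact ENNReal.Tendsto.mul h1 (Or.inr h3) h2 (Or.inr (hfinK u v))

/-- Convergence of kernels in `L²` gives almost everywhere convergence only along subsequences,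
which is what `hconv` records and what the subsequence principle requires. The square of the limit
dominates, since `L n ≤ K`. -/
lemma tendsto_lintegral_lpath_sub_sq {K : α → α → ℝ≥0∞} (hK : Measurable (Function.uncurry K))
    {L : ℕ → α → α → ℝ≥0∞} (hL : ∀ n, Measurable (Function.uncurry (L n)))
    (hLK : ∀ n u v, L n u v ≤ K u v) (hfinK : ∀ u v, K u v ≠ ∞)
    (hconv : ∀ ns : ℕ → ℕ, Tendsto ns atTop atTop → ∃ ms : ℕ → ℕ,
      ∀ᵐ u ∂ν, ∀ᵐ v ∂ν, Tendsto (fun n => L (ns (ms n)) u v) atTop (𝓝 (K u v)))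
    (k : ℕ) (hfin : ∀ j ≤ k, ∀ᵐ u ∂ν, lpath ν K j u ≠ ∞)
    (hsq : ∫⁻ u, lpath ν K k u ^ 2 ∂ν ≠ ∞) :
    Tendsto (fun n => ∫⁻ u, (lpath ν K k u - lpath ν (L n) k u) ^ 2 ∂ν) atTop (𝓝 0) := by
  refine tendsto_of_subseq_tendsto fun ns hns => ?_
  obtain ⟨ms, hms⟩ := hconv ns hns
  refine ⟨ms, ?_⟩
  rw [← lintegral_zero (μ := ν)]
  refine tendsto_lintegral_of_dominated_convergence (fun u => lpath ν K k u ^ 2)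
    (fun n => ((measurable_lpath hK k).sub (measurable_lpath (hL _) k)).pow_const 2)
    (fun n => ae_of_all _ fun u => pow_le_pow_left' tsub_le_self 2) hsq ?_
  filter_upwards [hfin k le_rfl, ae_tendsto_lpath (L := fun n => L (ns (ms n)))
    (fun n => hL _) (fun n => hLK _) hfinK hms k hfin] with u h1 h2
  have h3 := (ENNReal.Tendsto.sub (tendsto_const_nhds (x := lpath ν K k u)) h2 (Or.inl h1))
  simpa using ENNReal.Tendsto.pow (n := 2) h3

end Kernel

/-! ### The functions `θ_m` and the truncated kernels -/

section Theta

variable {w : I → I → ℝ}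

/-- The index shifts by one because `tau w` is already `T 1`. The identity holds at every `u`: where
the lower integral is infinite, both the Bochner integral and `toReal` take the default value `0`.
Finiteness almost everywhere is needed only under the integral sign. -/
lemma iterate_kernelOp_eq_toReal (hw : Measurable (Function.uncurry w))
    (hw0 : ∀ u v, 0 ≤ w u v) (k : ℕ)
    (hfin : ∀ j ≤ k, ∀ᵐ u : I, lpath volume (fun u v => ENNReal.ofReal (w u v)) j u ≠ ∞) (u : I) :
    (kernelOp w)^[k] (tau w) u
      = (lpath volume (fun u v => ENNReal.ofReal (w u v)) (k + 1) u).toReal := by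
  induction k generalizing u with
  | zero =>
    have hm : Measurable fun v => w u v := measurable_kernel_comp hw measurable_const measurable_id
    rw [Function.iterate_zero_apply, tau, lpath_succ, lkernelOp,
      integral_eq_lintegral_of_nonneg_ae (ae_of_all _ fun v => hw0 u v) hm.aestronglyMeasurable]
    simp [lpath_zero]
  | succ k ih =>
    have ih' := ih fun j hj => hfin j (by omega)
    have hm : Measurable fun v => w u v := measurable_kernel_comp hw measurable_const measurable_id
    have hK : Measurable (Function.uncurry fun u v => ENNReal.ofReal (w u v)) := hw.ennreal_ofReal
    rw [Function.iterate_succ_apply', kernelOp, lpath_succ, lkernelOp]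
    simp_rw [ih']
    rw [integral_eq_lintegral_of_nonneg_ae
      (ae_of_all _ fun v => mul_nonneg (hw0 u v) ENNReal.toReal_nonneg)
      (hm.mul (measurable_lpath hK (k + 1)).ennreal_toReal).aestronglyMeasurable]
    congr 1
    refine lintegral_congr_ae ?_
    filter_upwards [hfin (k + 1) le_rfl] with v hv
    rw [ENNReal.ofReal_mul (hw0 u v), ENNReal.ofReal_toReal hv]

lemma measurable_truncKernel (hw : Measurable (Function.uncurry w)) (ρ : ℝ) :
    Measurable (Function.uncurry (truncKernel w ρ)) := by
  classical
  have : Function.uncurry (truncKernel w ρ) =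
      fun p => if Function.uncurry w p ≤ ρ⁻¹ then Function.uncurry w p else 0 := by
    ext p; simp only [Function.uncurry, truncKernel]; congr
  rw [this]
  exact Measurable.ite (measurableSet_le hw measurable_const) hw measurable_const

lemma truncKernel_nonneg (hw0 : ∀ u v, 0 ≤ w u v) (ρ : ℝ) (u v : I) :
    0 ≤ truncKernel w ρ u v := by
  unfold truncKernel; split_ifs
  · exact hw0 u v
  · exact le_rfl

lemma truncKernel_le (hw0 : ∀ u v, 0 ≤ w u v) (ρ : ℝ) (u v : I) :
    truncKernel w ρ u v ≤ w u v := by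
  unfold truncKernel; split_ifs
  · exact le_rfl
  · exact hw0 u v

lemma truncKernel_symm (hs : ∀ u v, w u v = w v u) (ρ : ℝ) (u v : I) :
    truncKernel w ρ u v = truncKernel w ρ v u := by
  unfold truncKernel; rw [hs]

lemma measurable_edgeProb (hw : Measurable (Function.uncurry w)) (ρ : ℝ) :
    Measurable (Function.uncurry (edgeProb w ρ)) :=
  (measurable_truncKernel hw ρ).const_mul ρ

lemma edgeProb_nonneg (hw0 : ∀ u v, 0 ≤ w u v) {ρ : ℝ} (hρ : 0 < ρ) (u v : I) :
    0 ≤ edgeProb w ρ u v :=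
  mul_nonneg hρ.le (truncKernel_nonneg hw0 ρ u v)

lemma edgeProb_le_one {ρ : ℝ} (hρ : 0 < ρ) (u v : I) : edgeProb w ρ u v ≤ 1 := by
  unfold edgeProb truncKernel; split_ifs with h
  · calc ρ * w u v ≤ ρ * ρ⁻¹ := by gcongr
      _ = 1 := mul_inv_cancel₀ hρ.ne'
  · simp

lemma edgeProb_symm (hs : ∀ u v, w u v = w v u) (ρ : ℝ) (u v : I) :
    edgeProb w ρ u v = edgeProb w ρ v u := by
  unfold edgeProb; rw [truncKernel_symm hs]

/-- Convergence in `L²` implies convergence in measure, hence almost everywhere along a subsequence;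
Fubini's theorem passes to almost every section. -/
lemma exists_subseq_ae_tendsto_truncKernel (hw : Measurable (Function.uncurry w)) {ρ : ℕ → ℝ}
    (hρ : Tendsto
      (fun n => eLpNorm (fun p : I × I => truncKernel w (ρ n) p.1 p.2 - w p.1 p.2) 2 volume)
      atTop (𝓝 0)) (ns : ℕ → ℕ) (hns : Tendsto ns atTop atTop) :
    ∃ ms : ℕ → ℕ, ∀ᵐ u : I, ∀ᵐ v : I, Tendsto
      (fun n => ENNReal.ofReal (truncKernel w (ρ (ns (ms n))) u v)) atTop
      (𝓝 (ENNReal.ofReal (w u v))) := by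
  have h := tendstoInMeasure_of_tendsto_eLpNorm (μ := (volume : Measure (I × I))) (p := 2)
    (f := fun n p => truncKernel w (ρ (ns n)) p.1 p.2) (g := fun p => w p.1 p.2) (by simp)
    (fun n => (measurable_truncKernel hw _).aestronglyMeasurable) hw.aestronglyMeasurable
    (hρ.comp hns)
  obtain ⟨ms, -, hms⟩ := h.exists_seq_tendsto_ae
  refine ⟨ms, ?_⟩
  filter_upwards [Measure.ae_ae_of_ae_prod hms] with u hu
  filter_upwards [hu] with v hv
  exact (ENNReal.continuous_ofReal.tendsto _).comp hv

end Theta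

/-! ### Summation of edge-product weights over all graphs -/

section GraphSum

variable {n : ℕ}

open Classical in
-- A graph is the same as the set of its edges written as increasing pairs, and the right side,
-- expanded, is a sum over subsets of the increasing pairs.
lemma sum_simpleGraph_prod_ite {R : Type*} [CommSemiring R] (f g : Fin n × Fin n → R) :
    ∑ H : SimpleGraph (Fin n), ∏ p : Fin n × Fin n with p.1 < p.2,
        (if H.Adj p.1 p.2 then f p else g p)
      = ∏ p : Fin n × Fin n with p.1 < p.2, (f p + g p) := by
  rw [Finset.prod_add]
  refine Finset.sum_bij' (fun H _ => Finset.univ.filter fun p : Fin n × Fin n => p.1 < p.2 ∧ H.Adj p.1 p.2)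
    (fun t _ => SimpleGraph.fromRel fun a b => (a, b) ∈ t) ?_ ?_ ?_ ?_ ?_
  · intro H _
    rw [Finset.mem_powerset]
    intro p hp
    simp only [Finset.mem_filter, Finset.mem_univ, true_and] at hp ⊢
    exact hp.1
  · intro t _
    exact Finset.mem_univ _
  · intro H _
    ext a b
    simp only [SimpleGraph.fromRel_adj, Finset.mem_filter, Finset.mem_univ, true_and]
    constructor
    · rintro ⟨-, h | h⟩
      · exact h.2
      · exact h.2.symm
    · intro h
      rcases lt_or_gt_of_ne h.ne with hlt | hlt
      · exact ⟨h.ne, Or.inl ⟨hlt, h⟩⟩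
      · exact ⟨h.ne, Or.inr ⟨hlt, h.symm⟩⟩
  · intro t ht
    rw [Finset.mem_powerset] at ht
    ext ⟨a, b⟩
    simp only [SimpleGraph.fromRel_adj, Finset.mem_filter, Finset.mem_univ, true_and]
    constructor
    · rintro ⟨hlt, -, h | h⟩
      · exact h
      · have := ht h
        simp only [Finset.mem_filter, Finset.mem_univ, true_and] at this
        exact absurd hlt this.not_gt
    · intro h
      have := ht h
      simp only [Finset.mem_filter, Finset.mem_univ, true_and] at this
      exact ⟨this, this.ne, Or.inl h⟩
  · intro H _
    rw [Finset.prod_ite, Finset.filter_filter, Finset.filter_filter]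
    congr 2
    ext p
    simp only [Finset.mem_filter, Finset.mem_univ, true_and, Finset.mem_sdiff]
    tauto

open Classical in
/-- The total probability of the graphs that contain the given edges. -/
lemma sum_graphProb_of_edges {τ : Type*} {s : Finset τ} {e : τ → Fin n × Fin n}
    (hne : ∀ t ∈ s, (e t).1 ≠ (e t).2)
    (hinj : Set.InjOn (fun t => s((e t).1, (e t).2)) s) {h : I → I → ℝ}
    (hsymm : ∀ u v, h u v = h v u) (x : Fin n → I) :
    ∑ H : SimpleGraph (Fin n) with ∀ t ∈ s, H.Adj (e t).1 (e t).2, graphProb h x H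
      = ∏ t ∈ s, h (x (e t).1) (x (e t).2) := by
  -- `graphProb` has factors only at increasing pairs, so each prescribed edge is first oriented
  -- that way; symmetry of `h` makes this harmless.
  set nrm : Fin n × Fin n → Fin n × Fin n := fun p => if p.1 < p.2 then p else p.swap with hnrm
  have hadj : ∀ (H : SimpleGraph (Fin n)) p, H.Adj (nrm p).1 (nrm p).2 ↔ H.Adj p.1 p.2 := by
    intro H p
    simp only [hnrm]; split_ifs
    · rfl
    · exact H.adj_comm _ _
  have hh : ∀ p, h (x (nrm p).1) (x (nrm p).2) = h (x p.1) (x p.2) := by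
    intro p
    simp only [hnrm]; split_ifs
    · rfl
    · exact hsymm _ _
  have hlt : ∀ p : Fin n × Fin n, p.1 ≠ p.2 → (nrm p).1 < (nrm p).2 := by
    intro p hp
    simp only [hnrm]; split_ifs with h1
    · exact h1
    · exact lt_of_le_of_ne (not_lt.1 h1) hp.symm
  have hsym2 : ∀ p : Fin n × Fin n, s((nrm p).1, (nrm p).2) = s(p.1, p.2) := by
    intro p
    simp only [hnrm]; split_ifs
    · rfl
    · exact Sym2.eq_swap
  set S := s.image fun t => nrm (e t) with hS
  have hprodS : ∏ p ∈ S, h (x p.1) (x p.2) = ∏ t ∈ s, h (x (e t).1) (x (e t).2) := by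
    rw [hS, Finset.prod_image]
    · exact Finset.prod_congr rfl fun t _ => hh _
    · intro t ht t' ht' htt
      refine hinj ht ht' ?_
      change s((e t).1, (e t).2) = s((e t').1, (e t').2)
      rw [← hsym2 (e t), ← hsym2 (e t'), show nrm (e t) = nrm (e t') from htt]
  have hSE : S ⊆ Finset.univ.filter fun p : Fin n × Fin n => p.1 < p.2 := by
    intro p hp
    obtain ⟨t, ht, rfl⟩ := Finset.mem_image.1 hp
    simpa using hlt _ (hne t ht)
  have hcond : ∀ H : SimpleGraph (Fin n),
      (∀ t ∈ s, H.Adj (e t).1 (e t).2) ↔ ∀ p ∈ S, H.Adj p.1 p.2 := by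
    intro H
    simp only [hS, Finset.forall_mem_image, hadj]
  -- The constraint is absorbed into the weights: a missing prescribed edge gets weight `0`. The sum
  -- then factorizes, with factor `h` on `S` and `h + (1 - h) = 1` off `S`.
  have hterm : ∀ H : SimpleGraph (Fin n),
      (if ∀ t ∈ s, H.Adj (e t).1 (e t).2 then graphProb h x H else 0)
        = ∏ p : Fin n × Fin n with p.1 < p.2, (if H.Adj p.1 p.2 then h (x p.1) (x p.2)
          else if p ∈ S then 0 else 1 - h (x p.1) (x p.2)) := by
    intro H
    by_cases hc : ∀ t ∈ s, H.Adj (e t).1 (e t).2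
    · rw [if_pos hc]
      rw [hcond] at hc
      refine Finset.prod_congr rfl fun p _ => ?_
      by_cases ha : H.Adj p.1 p.2
      · simp [ha]
      · have : p ∉ S := fun hp => ha (hc p hp)
        simp [ha, this]
    · rw [if_neg hc]
      rw [hcond] at hc
      push Not at hc
      obtain ⟨p, hp, hpa⟩ := hc
      exact (Finset.prod_eq_zero (hSE hp) (by simp [hp, hpa])).symm
  rw [Finset.sum_filter, Finset.sum_congr rfl fun H _ => hterm H,
    sum_simpleGraph_prod_ite (fun p => h (x p.1) (x p.2))
      (fun p => if p ∈ S then 0 else 1 - h (x p.1) (x p.2)), ← hprodS,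
    ← Finset.prod_subset hSE (f := fun p => h (x p.1) (x p.2) +
      if p ∈ S then 0 else 1 - h (x p.1) (x p.2))]
  · exact Finset.prod_congr rfl fun p hp => by simp [hp]
  · intro p _ hp
    simp [hp]

end GraphSum

/-! ### Expectations on the event that prescribed edges are present -/

section Latent

variable {Ω : Type*} [MeasurableSpace Ω] {μ : Measure Ω} {n : ℕ}
  {h : I → I → ℝ} {ξ : Fin n → Ω → I} {G : Ω → SimpleGraph (Fin n)}

lemma graphProb_nonneg (h0 : ∀ u v, 0 ≤ h u v) (h1 : ∀ u v, h u v ≤ 1) (x : Fin n → I)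
    (H : SimpleGraph (Fin n)) : 0 ≤ graphProb h x H := by
  unfold graphProb
  refine Finset.prod_nonneg fun p _ => ?_
  split_ifs
  · exact h0 _ _
  · exact sub_nonneg.2 (h1 _ _)

lemma measurable_graphProb (hm : Measurable (Function.uncurry h)) (H : SimpleGraph (Fin n)) :
    Measurable fun x : Fin n → I => graphProb h x H := by
  unfold graphProb
  refine Finset.measurable_prod _ fun p _ => ?_
  have := measurable_kernel_comp hm (measurable_pi_apply (X := fun _ : Fin n => I) p.1)
    (measurable_pi_apply p.2)
  split_ifs
  · exact this
  · exact this.const_sub 1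

namespace IsLatentGraph

lemma measurable_latent_pi (hG : IsLatentGraph μ h ξ G) : Measurable fun ω i => ξ i ω :=
  measurable_pi_lambda _ hG.measurable_latent

lemma measurableSet_eq (hG : IsLatentGraph μ h ξ G) (H : SimpleGraph (Fin n)) :
    MeasurableSet {ω | G ω = H} := by
  have : {ω | G ω = H} = ⋂ i, ⋂ j, {ω | (G ω).Adj i j ↔ H.Adj i j} := by
    ext ω
    simp only [Set.mem_ofPred_eq, Set.mem_iInter, SimpleGraph.ext_iff, funext_iff, eq_iff_iff]
  rw [this]
  refine MeasurableSet.iInter fun i => MeasurableSet.iInter fun j => ?_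
  by_cases hij : H.Adj i j
  · simpa [hij] using hG.measurableSet_adj i j
  · simp only [hij, iff_false]
    exact (hG.measurableSet_adj i j).compl

lemma measurableSet_edges (hG : IsLatentGraph μ h ξ G) {τ : Type*} (s : Finset τ)
    (e : τ → Fin n × Fin n) : MeasurableSet {ω | ∀ t ∈ s, (G ω).Adj (e t).1 (e t).2} := by
  simp only [Set.ofPred_forall]
  exact Finset.measurableSet_biInter s fun t _ => hG.measurableSet_adj _ _

variable [IsProbabilityMeasure μ]

lemma map_latent (hG : IsLatentGraph μ h ξ G) :
    μ.map (fun ω i => ξ i ω) = Measure.pi fun _ => volume := by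
  rw [(iIndepFun_iff_map_fun_eq_pi_map fun i => (hG.measurable_latent i).aemeasurable).1
    hG.indep_latent]
  simp_rw [hG.uniform_latent]

/-- The event is a finite disjoint union of the events `G = H`, to which the conditional law
applies. The hypothesis `hinj` makes the undirected edges distinct; otherwise an edge probability
would be counted more than once. -/
lemma map_restrict_edges (hG : IsLatentGraph μ h ξ G) (hm : Measurable (Function.uncurry h))
    (h0 : ∀ u v, 0 ≤ h u v) (h1 : ∀ u v, h u v ≤ 1) (hsymm : ∀ u v, h u v = h v u)
    {τ : Type*} {s : Finset τ} {e : τ → Fin n × Fin n} (hne : ∀ t ∈ s, (e t).1 ≠ (e t).2)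
    (hinj : Set.InjOn (fun t => s((e t).1, (e t).2)) s) :
    (μ.restrict {ω | ∀ t ∈ s, (G ω).Adj (e t).1 (e t).2}).map (fun ω i => ξ i ω)
      = (Measure.pi fun _ => volume).withDensity
          fun x => ∏ t ∈ s, ENNReal.ofReal (h (x (e t).1) (x (e t).2)) := by
  classical
  ext B hB
  have hξ := hG.measurable_latent_pi
  have hBm : MeasurableSet {ω | (fun i => ξ i ω) ∈ B} := hξ hB
  have hdens : ∀ x : Fin n → I, ∏ t ∈ s, ENNReal.ofReal (h (x (e t).1) (x (e t).2))
      = ∑ H : SimpleGraph (Fin n) with ∀ t ∈ s, H.Adj (e t).1 (e t).2,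
        ENNReal.ofReal (graphProb h x H) := by
    intro x
    rw [← ENNReal.ofReal_prod_of_nonneg fun t _ => h0 _ _,
      ← ENNReal.ofReal_sum_of_nonneg fun H _ => graphProb_nonneg h0 h1 x H,
      ← sum_graphProb_of_edges hne hinj hsymm x]
  rw [Measure.map_apply hξ hB, withDensity_apply _ hB, ← hG.map_latent,
    setLIntegral_map hB (Finset.measurable_prod _ fun t _ =>
      (measurable_kernel_comp hm (measurable_pi_apply (e t).1) (measurable_pi_apply (e t).2)).ennreal_ofReal) hξ,
    Measure.restrict_apply' (hG.measurableSet_edges s e)]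
  rw [lintegral_congr fun ω => hdens fun i => ξ i ω]
  have hgm : ∀ H : SimpleGraph (Fin n),
      Measurable fun ω => ENNReal.ofReal (graphProb h (fun i => ξ i ω) H) := fun H =>
    ((measurable_graphProb hm H).comp hξ).ennreal_ofReal
  rw [lintegral_finsetSum _ fun H _ => hgm H]
  have hU : (fun ω i => ξ i ω) ⁻¹' B ∩ {ω | ∀ t ∈ s, (G ω).Adj (e t).1 (e t).2}
      = ⋃ H ∈ (Finset.univ.filter fun H : SimpleGraph (Fin n) =>
          ∀ t ∈ s, H.Adj (e t).1 (e t).2), {ω | (fun i => ξ i ω) ∈ B ∧ G ω = H} := by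
    ext ω
    simp only [Set.mem_inter_iff, Set.mem_preimage, Set.mem_ofPred_eq, Set.mem_iUnion,
      Finset.mem_filter, Finset.mem_univ, true_and]
    constructor
    · rintro ⟨h1, h2⟩
      exact ⟨G ω, h2, h1, rfl⟩
    · rintro ⟨H, h2, h1, rfl⟩
      exact ⟨h1, h2⟩
  rw [hU, measure_biUnion_finset]
  · exact Finset.sum_congr rfl fun H _ => hG.conditional_law H B hB
  · intro H _ H' _ hHH
    rw [Function.onFun, Set.disjoint_left]
    rintro ω ⟨-, h1⟩ ⟨-, h2⟩
    exact hHH (h1.symm.trans h2)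
  · intro H _
    exact hBm.inter (hG.measurableSet_eq H)

/-- The expectation of a function of the latent variables on the event that the graph contains
the given edges. -/
lemma lintegral_edges (hG : IsLatentGraph μ h ξ G) (hm : Measurable (Function.uncurry h))
    (h0 : ∀ u v, 0 ≤ h u v) (h1 : ∀ u v, h u v ≤ 1) (hsymm : ∀ u v, h u v = h v u)
    {τ : Type*} {s : Finset τ} {e : τ → Fin n × Fin n} (hne : ∀ t ∈ s, (e t).1 ≠ (e t).2)
    (hinj : Set.InjOn (fun t => s((e t).1, (e t).2)) s) {f : (Fin n → I) → ℝ≥0∞}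
    (hf : Measurable f) :
    ∫⁻ ω in {ω | ∀ t ∈ s, (G ω).Adj (e t).1 (e t).2}, f (fun i => ξ i ω) ∂μ
      = ∫⁻ x, (∏ t ∈ s, ENNReal.ofReal (h (x (e t).1) (x (e t).2))) * f x
          ∂(Measure.pi fun _ => volume) := by
  have hd : Measurable fun x : Fin n → I =>
      ∏ t ∈ s, ENNReal.ofReal (h (x (e t).1) (x (e t).2)) :=
    Finset.measurable_prod _ fun t _ =>
      (measurable_kernel_comp hm (measurable_pi_apply (e t).1) (measurable_pi_apply (e t).2)).ennreal_ofReal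
  rw [← lintegral_map hf hG.measurable_latent_pi,
    hG.map_restrict_edges hm h0 h1 hsymm hne hinj, lintegral_withDensity_eq_lintegral_mul _ hd hf]
  rfl

end IsLatentGraph

end Latent

/-! ### Self-avoiding paths and their edges -/

section Paths

variable {n k : ℕ}

open Classical in
/-- The sequences of `k + 1` distinct vertices that start at `i`. -/
noncomputable def paths (k : ℕ) (i : Fin n) : Finset (Fin (k + 1) → Fin n) :=
  Finset.univ.filter fun p => Function.Injective p ∧ p 0 = i

lemma mem_paths {i : Fin n} {p : Fin (k + 1) → Fin n} :
    p ∈ paths k i ↔ Function.Injective p ∧ p 0 = i := by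
  simp [paths]

/-- The event that `p` is a path of the random graph. -/
def pathEvent {Ω : Type*} (G : Ω → SimpleGraph (Fin n)) (p : Fin (k + 1) → Fin n) : Set Ω :=
  {ω | ∀ j : Fin k, (G ω).Adj (p j.castSucc) (p j.succ)}

lemma pathDegree_eq_sum {Ω : Type*} (G : Ω → SimpleGraph (Fin n)) (i : Fin n) (ω : Ω) :
    (pathDegree (G ω) k i : ℝ) = ∑ p ∈ paths k i, (pathEvent G p).indicator (fun _ => 1) ω := by
  classical
  simp only [Set.indicator_apply, pathEvent, Set.mem_ofPred_eq]
  rw [Finset.sum_ite, Finset.sum_const_zero, add_zero, Finset.sum_const, nsmul_one, pathDegree]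
  congr 2
  ext p
  simp [mem_paths, and_assoc]

lemma injective_path_edges {p : Fin (k + 1) → Fin n} (hp : Function.Injective p) :
    Function.Injective fun j : Fin k => s(p j.castSucc, p j.succ) := by
  intro a b hab
  rcases Sym2.eq_iff.1 hab with ⟨h1, -⟩ | ⟨h1, h2⟩
  · exact Fin.castSucc_injective _ (hp h1)
  · have h1 := congrArg Fin.val (hp h1)
    have h2 := congrArg Fin.val (hp h2)
    simp only [Fin.val_castSucc, Fin.val_succ] at h1 h2
    omega

lemma path_edge_ne {p : Fin (k + 1) → Fin n} (hp : Function.Injective p) (j : Fin k) :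
    p j.castSucc ≠ p j.succ :=
  fun h => (Fin.castSucc_lt_succ (i := j)).ne (hp h)

/-- The edges of two paths, the second path being indexed by a second copy of `Fin k`. -/
def pairEdges (p q : Fin (k + 1) → Fin n) : Fin k ⊕ Fin k → Fin n × Fin n :=
  Sum.elim (fun j => (p j.castSucc, p j.succ)) fun j => (q j.castSucc, q j.succ)

lemma pairEdges_ne {p q : Fin (k + 1) → Fin n} (hp : Function.Injective p)
    (hq : Function.Injective q) (t : Fin k ⊕ Fin k) : (pairEdges p q t).1 ≠ (pairEdges p q t).2 := by
  rcases t with j | j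
  · exact path_edge_ne hp j
  · exact path_edge_ne hq j

/-- An edge of `q` whose later endpoint lies off `p` cannot be an edge of `p` in either orientation.
Retaining only such edges of `q`, indexed by `J`, therefore leaves distinct edges altogether. -/
lemma injOn_pairEdges {p q : Fin (k + 1) → Fin n} (hp : Function.Injective p)
    (hq : Function.Injective q) {J : Finset (Fin k)} (hJ : ∀ j ∈ J, ∀ l, q j.succ ≠ p l) :
    Set.InjOn (fun t => s((pairEdges p q t).1, (pairEdges p q t).2))
      (Finset.univ.disjSum J : Finset (Fin k ⊕ Fin k)) := by
  have key : ∀ a : Fin k, ∀ b ∈ J, s(p a.castSucc, p a.succ) ≠ s(q b.castSucc, q b.succ) := by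
    intro a b hb h
    rcases Sym2.eq_iff.1 h with ⟨-, h⟩ | ⟨h, -⟩
    · exact hJ b hb _ h.symm
    · exact hJ b hb _ h.symm
  rintro (a | a) ha (b | b) hb h
  · exact congrArg _ (injective_path_edges hp h)
  · exact absurd h (key a b (by simpa using hb))
  · exact absurd h.symm (key b a (by simpa using ha))
  · exact congrArg _ (injective_path_edges hq h)

/-- Deleting the start leaves an injective sequence of `k` vertices other than `i`. -/
lemma card_paths (k : ℕ) (i : Fin n) : (paths k i).card = (n - 1).descFactorial k := by
  classical
  have h1 : Fintype.card (Fin k ↪ {v : Fin n // v ≠ i}) = (n - 1).descFactorial k := by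
    rw [Fintype.card_embedding_eq, Fintype.card_fin]
    congr 1
    simp [Fintype.card_subtype_compl]
  rw [← h1, ← Finset.card_univ]
  refine Finset.card_bij' (fun p hp => ⟨fun j => ⟨p j.succ, fun h =>
      Fin.succ_ne_zero j ((mem_paths.1 hp).1 (h.trans (mem_paths.1 hp).2.symm))⟩, fun a b h =>
      Fin.succ_injective _ ((mem_paths.1 hp).1 (congrArg Subtype.val h))⟩)
    (fun r _ => Fin.cons i fun j => (r j).1) (fun _ _ => Finset.mem_univ _) ?_ ?_ ?_
  · intro r _
    rw [mem_paths]
    refine ⟨Fin.cons_injective_iff.2 ⟨?_, fun a b h => r.injective (Subtype.ext h)⟩, rfl⟩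
    rintro ⟨j, hj⟩
    exact (r j).2 hj
  · intro p hp
    funext j
    refine Fin.cases ?_ (fun j => ?_) j
    · exact (mem_paths.1 hp).2.symm
    · rfl
  · intro r _
    rfl

end Paths

/-! ### Joint probabilities of two paths with a common start -/

section SecondMoment

variable {Ω : Type*} [MeasurableSpace Ω] {μ : Measure Ω} {n : ℕ}
  {h : I → I → ℝ} {ξ : Fin n → Ω → I} {G : Ω → SimpleGraph (Fin n)}

namespace IsLatentGraph

lemma lintegral_latent (hG : IsLatentGraph μ h ξ G) {f : I → ℝ≥0∞} (hf : Measurable f)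
    (i : Fin n) : ∫⁻ ω, f (ξ i ω) ∂μ = ∫⁻ u, f u := by
  rw [← hG.uniform_latent i, lintegral_map hf (hG.measurable_latent i)]

lemma measurableSet_pathEvent (hG : IsLatentGraph μ h ξ G) {k : ℕ} (p : Fin (k + 1) → Fin n) :
    MeasurableSet (pathEvent G p) := by
  unfold pathEvent
  rw [Set.ofPred_forall]
  exact MeasurableSet.iInter fun j => hG.measurableSet_adj _ _

variable [IsProbabilityMeasure μ]

/-- Given the latent variable at the start, the path has probability `lpath … k`. The cross terms of
the variance are thus the same second moment as that of the conditional mean. -/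
lemma setLIntegral_pathEvent (hG : IsLatentGraph μ h ξ G) (hm : Measurable (Function.uncurry h))
    (h0 : ∀ u v, 0 ≤ h u v) (h1 : ∀ u v, h u v ≤ 1) (hsymm : ∀ u v, h u v = h v u)
    {k : ℕ} {p : Fin (k + 1) → Fin n} (hp : Function.Injective p) :
    ∫⁻ ω in pathEvent G p, lpath volume (fun u v => ENNReal.ofReal (h u v)) k (ξ (p 0) ω) ∂μ
      = ∫⁻ u, lpath volume (fun u v => ENNReal.ofReal (h u v)) k u ^ 2 := by
  set K : I → I → ℝ≥0∞ := fun u v => ENNReal.ofReal (h u v) with hKdef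
  have hK : Measurable (Function.uncurry K) := hm.ennreal_ofReal
  have hL : Measurable fun x : Fin n → I => lpath volume K k (x (p 0)) :=
    (measurable_lpath hK k).comp (measurable_pi_apply _)
  have hset : pathEvent G p = {ω | ∀ t ∈ (Finset.univ : Finset (Fin k)),
      (G ω).Adj (p t.castSucc, p t.succ).1 (p t.castSucc, p t.succ).2} := by
    ext ω; simp [pathEvent]
  rw [hset, hG.lintegral_edges hm h0 h1 hsymm (s := Finset.univ)
    (e := fun t : Fin k => (p t.castSucc, p t.succ)) (fun t _ => path_edge_ne hp t)
    (injective_path_edges hp).injOn hL]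
  have h2 := lintegral_path (ν := volume) hK k hp hL
    (fun j x t => by rw [Function.update_of_ne (fun h => Fin.succ_ne_zero j (hp h).symm)])
    (g := 1) measurable_one
  rw [← lintegral_eval_pi (ν := volume) ((measurable_lpath hK k).pow_const 2) (p 0)]
  simp only [Pi.one_apply, mul_one] at h2
  simp_rw [sq]
  refine Eq.trans (lintegral_congr fun x => mul_comm _ _) h2

/-- The paths meet only at their start and are conditionally independent given its latent variable.
The vertices of `q` are integrated out first, with the edges of `p` as the inert factor `F`, and
then those of `p`. The value matches the cross terms, so such pairs contribute nothing to the
variance. -/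
lemma measure_pathEvent_inter_of_disjoint (hG : IsLatentGraph μ h ξ G)
    (hm : Measurable (Function.uncurry h)) (h0 : ∀ u v, 0 ≤ h u v) (h1 : ∀ u v, h u v ≤ 1)
    (hsymm : ∀ u v, h u v = h v u) {k : ℕ} {p q : Fin (k + 1) → Fin n}
    (hp : Function.Injective p) (hq : Function.Injective q) (hpq : p 0 = q 0)
    (hdisj : ∀ (j : Fin k) l, q j.succ ≠ p l) :
    μ (pathEvent G p ∩ pathEvent G q)
      = ∫⁻ u, lpath volume (fun u v => ENNReal.ofReal (h u v)) k u ^ 2 := by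
  set K : I → I → ℝ≥0∞ := fun u v => ENNReal.ofReal (h u v) with hKdef
  have hK : Measurable (Function.uncurry K) := hm.ennreal_ofReal
  have hset : pathEvent G p ∩ pathEvent G q = {ω | ∀ t ∈ Finset.univ.disjSum Finset.univ,
      (G ω).Adj (pairEdges p q t).1 (pairEdges p q t).2} := by
    ext ω; simp [pathEvent, pairEdges]
  have hE := hG.lintegral_edges hm h0 h1 hsymm (fun t _ => pairEdges_ne hp hq t)
    (injOn_pairEdges hp hq (J := Finset.univ) fun j _ => hdisj j) (f := fun _ => 1)
    measurable_const
  rw [setLIntegral_one] at hE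
  rw [hset, hE]
  have hF : Measurable fun x : Fin n → I => ∏ j : Fin k, K (x (p j.castSucc)) (x (p j.succ)) :=
    Finset.measurable_prod _ fun j _ =>
      measurable_kernel_comp hK (measurable_pi_apply _) (measurable_pi_apply _)
  have h2 := lintegral_path (ν := volume) hK k hq hF
    (fun j x t => by
      refine Finset.prod_congr rfl fun l _ => ?_
      rw [Function.update_of_ne (hdisj j _).symm, Function.update_of_ne (hdisj j _).symm])
    (g := 1) measurable_one
  have hL : Measurable fun x : Fin n → I => lpath volume K k (x (p 0)) :=
    (measurable_lpath hK k).comp (measurable_pi_apply _)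
  have h3 := lintegral_path (ν := volume) hK k hp hL
    (fun j x t => by rw [Function.update_of_ne (fun h => Fin.succ_ne_zero j (hp h).symm)])
    (g := 1) measurable_one
  rw [← lintegral_eval_pi (ν := volume) ((measurable_lpath hK k).pow_const 2) (p 0)]
  simp only [Pi.one_apply, mul_one] at h2 h3
  simp_rw [sq]
  calc _ = ∫⁻ x : Fin n → I, (∏ j : Fin k, K (x (p j.castSucc)) (x (p j.succ)))
        * ∏ j : Fin k, K (x (q j.castSucc)) (x (q j.succ)) ∂(Measure.pi fun _ : Fin n => volume) := by
        refine lintegral_congr fun x => ?_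
        rw [Finset.prod_disjSum, mul_one]
        rfl
    _ = ∫⁻ x : Fin n → I, lpath volume K k (x (p 0)) * ∏ j : Fin k, K (x (p j.castSucc)) (x (p j.succ))
          ∂(Measure.pi fun _ : Fin n => volume) := by
        rw [h2, hpq]
        exact lintegral_congr fun x => mul_comm _ _
    _ = _ := h3

/-- The edges of `q` outside `J` are discarded. The remaining `k + J.card ≤ 2 * m` edges are
distinct; each yields a factor `ρ`, and the truncated weights are bounded by `w`. -/
lemma measure_pathEvent_inter_le {w : I → I → ℝ} {ρ : ℝ} (hρ : 0 < ρ)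
    (hG : IsLatentGraph μ (edgeProb w ρ) ξ G) (hw : Measurable (Function.uncurry w))
    (hw0 : ∀ u v, 0 ≤ w u v) (hsymm : ∀ u v, w u v = w v u) {k m : ℕ} (hk : k ≠ 0) (hkm : k ≤ m)
    {p q : Fin (k + 1) → Fin n} (hp : Function.Injective p) (hq : Function.Injective q)
    {J : Finset (Fin k)} (hJ : ∀ j ∈ J, ∀ l, q j.succ ≠ p l) :
    μ (pathEvent G p ∩ pathEvent G q) ≤ ENNReal.ofReal ρ ^ (k + J.card)
      * momentBound volume (fun u v => ENNReal.ofReal (w u v)) m := by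
  set K : I → I → ℝ≥0∞ := fun u v => ENNReal.ofReal (w u v) with hKdef
  have hK : Measurable (Function.uncurry K) := hw.ennreal_ofReal
  set s : Finset (Fin k ⊕ Fin k) := Finset.univ.disjSum J with hs
  have hcard : s.card = k + J.card := by simp [hs]
  have hJk : J.card ≤ k := (Finset.card_le_univ J).trans (Fintype.card_fin k).le
  have hsub : pathEvent G p ∩ pathEvent G q ⊆ {ω | ∀ t ∈ s,
      (G ω).Adj (pairEdges p q t).1 (pairEdges p q t).2} := by
    rintro ω ⟨h1, h2⟩ (j | j) -
    · exact h1 j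
    · exact h2 j
  have hE := hG.lintegral_edges (measurable_edgeProb hw ρ) (edgeProb_nonneg hw0 hρ)
    (edgeProb_le_one hρ) (edgeProb_symm hsymm ρ) (fun t _ => pairEdges_ne hp hq t)
    (injOn_pairEdges hp hq hJ) (f := fun _ => 1) measurable_const
  rw [setLIntegral_one] at hE
  have hne : s.Nonempty := by rw [← Finset.card_pos, hcard]; omega
  refine (measure_mono hsub).trans (hE.trans_le ?_)
  calc _ ≤ ∫⁻ x : Fin n → I, ENNReal.ofReal ρ ^ (k + J.card) * ∏ t ∈ s,
          K (x (pairEdges p q t).1) (x (pairEdges p q t).2) ∂(Measure.pi fun _ : Fin n => volume) := by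
        refine lintegral_mono fun x => ?_
        rw [mul_one, ← hcard, ← Finset.prod_const, ← Finset.prod_mul_distrib]
        refine Finset.prod_le_prod' fun t _ => ?_
        rw [hKdef, ← ENNReal.ofReal_mul hρ.le]
        exact ENNReal.ofReal_le_ofReal (mul_le_mul_of_nonneg_left (truncKernel_le hw0 _ _ _) hρ.le)
    _ = ENNReal.ofReal ρ ^ (k + J.card) * ∫⁻ x : Fin n → I, ∏ t ∈ s,
          K (x (pairEdges p q t).1) (x (pairEdges p q t).2) ∂(Measure.pi fun _ : Fin n => volume) :=
        lintegral_const_mul _ (Finset.measurable_prod _ fun t _ =>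
          measurable_kernel_comp hK (measurable_pi_apply _) (measurable_pi_apply _))
    _ ≤ _ := by
        gcongr
        refine (lintegral_prod_edges_le hne (fun t _ => pairEdges_ne hp hq t) hK).trans ?_
        rw [momentBound, hcard]
        refine mul_le_mul' ?_ (lintegral_kernel_pow_le K (by omega))
        have : k + J.card ≤ 2 * m := by omega
        exact_mod_cast this

end IsLatentGraph

end SecondMoment

/-! ### Counting overlapping pairs of paths -/

section Counting

variable {n k : ℕ}

open Classical in
-- A vertex of `q` on `p` has weight `1`, one off `p` has weight `ρ`. A union bound over the
-- position of an overlap, with injectivity of `q` dropped, leaves a sum of products that factorizes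
-- over positions. The overlapping position contributes at most `k + 1`, each of the others at most
-- `k + 1 + (n - 1) * ρ`.
lemma sum_overlap_le {ρ : ℝ} (hρ : 0 ≤ ρ) (i : Fin n) (p : Fin (k + 1) → Fin n) :
    ∑ q ∈ paths k i with ∃ (j : Fin k) (l : Fin (k + 1)), q j.succ = p l,
        ρ ^ (k + (Finset.univ.filter fun j : Fin k => ∀ l, q j.succ ≠ p l).card)
      ≤ ρ ^ k * (k * ((k + 1) * (k + 1 + (n - 1) * ρ) ^ (k - 1))) := by
  set c : Fin n → ℝ := fun v => if ∃ l, v = p l then 1 else 0 with hc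
  set a : Fin n → ℝ := fun v => if ∃ l, v = p l then 1 else ρ with ha
  have hc0 : ∀ v, 0 ≤ c v := fun v => by simp only [hc]; split_ifs <;> simp
  have ha0 : ∀ v, 0 ≤ a v := fun v => by simp only [ha]; split_ifs <;> simp [hρ]
  have hcsum : ∑ v, c v ≤ k + 1 := by
    simp only [hc, Finset.sum_boole]
    have : (Finset.univ.filter fun v => ∃ l, v = p l) ⊆ Finset.univ.image p := by
      intro v hv
      obtain ⟨l, rfl⟩ := (Finset.mem_filter.1 hv).2
      exact Finset.mem_image_of_mem _ (Finset.mem_univ _)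
    have := (Finset.card_le_card this).trans Finset.card_image_le
    rw [Finset.card_univ, Fintype.card_fin] at this
    exact_mod_cast this
  -- At most `n - 1` vertices lie off `p`, since `p 0` lies on it.
  have hasum : ∑ v, a v ≤ k + 1 + (n - 1) * ρ := by
    have h1 : ∀ v, a v = c v + (if ∃ l, v = p l then 0 else 1) * ρ := by
      intro v; simp only [ha, hc]; split_ifs <;> simp
    rw [Finset.sum_congr rfl fun v _ => h1 v, Finset.sum_add_distrib, ← Finset.sum_mul]
    refine add_le_add hcsum (mul_le_mul_of_nonneg_right ?_ hρ)
    calc ∑ v, (if ∃ l, v = p l then (0 : ℝ) else 1)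
        ≤ ∑ v : Fin n, (if v = p 0 then (0 : ℝ) else 1) := by
          refine Finset.sum_le_sum fun v _ => ?_
          by_cases hv : v = p 0
          · rw [if_pos ⟨0, hv⟩, if_pos hv]
          · rw [if_neg hv]; split_ifs <;> simp
      _ = n - 1 := by
          have : ∀ v : Fin n, (if v = p 0 then (0 : ℝ) else 1) = 1 - if v = p 0 then 1 else 0 :=
            fun v => by split_ifs <;> simp
          rw [Finset.sum_congr rfl fun v _ => this v, Finset.sum_sub_distrib]
          simp
  set g : (Fin k → Fin n) → ℝ := fun r => (∑ j, c (r j)) * ∏ j, a (r j) with hg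
  have hg0 : ∀ r, 0 ≤ g r := fun r =>
    mul_nonneg (Finset.sum_nonneg fun j _ => hc0 _) (Finset.prod_nonneg fun j _ => ha0 _)
  set F := (paths k i).filter fun q => ∃ (j : Fin k) (l : Fin (k + 1)), q j.succ = p l with hF
  have hterm : ∀ q ∈ F, ρ ^ (k + (Finset.univ.filter fun j : Fin k => ∀ l, q j.succ ≠ p l).card)
      ≤ ρ ^ k * g (Fin.tail q) := by
    intro q hq
    obtain ⟨j0, l0, hjl⟩ := (Finset.mem_filter.1 hq).2
    rw [pow_add]
    refine mul_le_mul_of_nonneg_left ?_ (pow_nonneg hρ k)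
    have h1 : ∏ j, a (Fin.tail q j)
        = ρ ^ (Finset.univ.filter fun j : Fin k => ∀ l, q j.succ ≠ p l).card := by
      simp only [ha, Finset.prod_ite, Finset.prod_const_one, one_mul, Finset.prod_const, Fin.tail]
      congr 2
      ext j
      simp
    have h2 : 1 ≤ ∑ j, c (Fin.tail q j) := by
      have h3 : c (Fin.tail q j0) = 1 := if_pos ⟨l0, hjl⟩
      rw [← h3]
      exact Finset.single_le_sum (f := fun j => c (Fin.tail q j)) (fun j _ => hc0 _)
        (Finset.mem_univ j0)
    rw [← h1]
    exact le_mul_of_one_le_left (Finset.prod_nonneg fun j _ => ha0 _) h2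
  have hinj : Set.InjOn (fun q : Fin (k + 1) → Fin n => (Fin.tail q : Fin k → Fin n)) F := by
    intro q hq q' hq' h
    have h1 := (mem_paths.1 (Finset.mem_filter.1 hq).1).2
    have h2 := (mem_paths.1 (Finset.mem_filter.1 hq').1).2
    rw [← Fin.cons_self_tail q, ← Fin.cons_self_tail q', h1, h2]
    exact congrArg _ h
  have hprod : ∀ j0 : Fin k, ∑ r : Fin k → Fin n, c (r j0) * ∏ j, a (r j)
      ≤ (k + 1) * (k + 1 + (n - 1) * ρ) ^ (k - 1) := by
    intro j0
    -- At position `j0` the product `c * a` equals `c`, because `a = 1` wherever `c = 1`.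
    have h1 : ∀ r : Fin k → Fin n, c (r j0) * ∏ j, a (r j)
        = ∏ j, (if j = j0 then c (r j) else a (r j)) := by
      intro r
      rw [← Finset.mul_prod_erase Finset.univ _ (Finset.mem_univ j0),
        ← Finset.mul_prod_erase Finset.univ (fun j => if j = j0 then c (r j) else a (r j))
          (Finset.mem_univ j0), if_pos rfl, ← mul_assoc]
      congr 1
      · simp only [hc, ha]; split_ifs <;> simp
      · exact Finset.prod_congr rfl fun j hj => (if_neg (Finset.ne_of_mem_erase hj)).symm
    have h2 := Finset.prod_univ_sum (fun _ : Fin k => (Finset.univ : Finset (Fin n)))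
      (fun j v => if j = j0 then c v else a v)
    rw [Fintype.piFinset_univ] at h2
    rw [Finset.sum_congr rfl fun r _ => h1 r, ← h2,
      ← Finset.mul_prod_erase Finset.univ _ (Finset.mem_univ j0)]
    simp only [if_true]
    refine mul_le_mul hcsum ?_ (Finset.prod_nonneg fun j _ => Finset.sum_nonneg fun v _ => ?_)
      (by positivity)
    · calc _ = ∏ j ∈ Finset.univ.erase j0, ∑ v, a v :=
            Finset.prod_congr rfl fun j hj => by simp [Finset.ne_of_mem_erase hj]
        _ = (∑ v, a v) ^ (k - 1) := by
            rw [Finset.prod_const, Finset.card_erase_of_mem (Finset.mem_univ _), Finset.card_univ,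
              Fintype.card_fin]
        _ ≤ _ := pow_le_pow_left₀ (Finset.sum_nonneg fun v _ => ha0 v) hasum _
    · split_ifs
      · exact hc0 v
      · exact ha0 v
  calc _ ≤ ∑ q ∈ F, ρ ^ k * g (Fin.tail q) := Finset.sum_le_sum hterm
    _ = ρ ^ k * ∑ r ∈ F.image fun q => (Fin.tail q : Fin k → Fin n), g r := by
        rw [← Finset.mul_sum, Finset.sum_image hinj]
    _ ≤ ρ ^ k * ∑ r, g r := mul_le_mul_of_nonneg_left
        (Finset.sum_le_univ_sum_of_nonneg hg0) (pow_nonneg hρ k)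
    _ = ρ ^ k * ∑ j0, ∑ r : Fin k → Fin n, c (r j0) * ∏ j, a (r j) := by
        rw [Finset.sum_comm]
        simp only [hg, Finset.sum_mul]
    _ ≤ ρ ^ k * ∑ _j0 : Fin k, ((k + 1) * (k + 1 + (n - 1) * ρ) ^ (k - 1) : ℝ) :=
        mul_le_mul_of_nonneg_left (Finset.sum_le_sum fun j0 _ => hprod j0) (pow_nonneg hρ k)
    _ = _ := by simp

end Counting

/-! ### Concentration of path counts around their conditional means -/

section Variance

variable {Ω : Type*} [MeasurableSpace Ω] {μ : Measure Ω} [IsProbabilityMeasure μ] {n : ℕ}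
  {w : I → I → ℝ} {ρ : ℝ} {ξ : Fin n → Ω → I} {G : Ω → SimpleGraph (Fin n)}

namespace IsLatentGraph

lemma memLp_indicator_pathEvent_sub (hρ : 0 < ρ) (hG : IsLatentGraph μ (edgeProb w ρ) ξ G)
    (hw : Measurable (Function.uncurry w)) (k : ℕ) (i : Fin n) (p : Fin (k + 1) → Fin n) :
    MemLp (fun ω => (pathEvent G p).indicator (fun _ => (1 : ℝ)) ω -
      (lpath volume (fun u v => ENNReal.ofReal (edgeProb w ρ u v)) k (ξ i ω)).toReal) ∞ μ := by
  set K : I → I → ℝ≥0∞ := fun u v => ENNReal.ofReal (edgeProb w ρ u v) with hKdef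
  have hK : Measurable (Function.uncurry K) := (measurable_edgeProb hw ρ).ennreal_ofReal
  have hK1 : ∀ u v, K u v ≤ 1 := fun u v => by
    simpa [hKdef] using edgeProb_le_one (w := w) hρ u v
  have hm : Measurable fun ω => (lpath volume K k (ξ i ω)).toReal :=
    ((measurable_lpath hK k).comp (hG.measurable_latent i)).ennreal_toReal
  refine MemLp.sub ?_ ?_
  · exact (memLp_const (1 : ℝ)).indicator (hG.measurableSet_pathEvent p)
  · refine memLp_top_of_bound hm.aestronglyMeasurable 1 (ae_of_all _ fun ω => ?_)
    rw [Real.norm_of_nonneg ENNReal.toReal_nonneg]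
    exact ENNReal.toReal_le_of_le_ofReal zero_le_one (by simpa using lpath_le_one hK1 k _)

/-- Expanding the product gives the joint probability, two cross terms and the square of the
conditional mean. By `setLIntegral_pathEvent` the last three integrals coincide, and the signs leave
one copy with a minus. -/
lemma integral_pathEvent_sub_mul (hρ : 0 < ρ) (hG : IsLatentGraph μ (edgeProb w ρ) ξ G)
    (hw : Measurable (Function.uncurry w)) (hw0 : ∀ u v, 0 ≤ w u v)
    (hsymm : ∀ u v, w u v = w v u) {k : ℕ} {i : Fin n} {p q : Fin (k + 1) → Fin n}
    (hp : p ∈ paths k i) (hq : q ∈ paths k i) :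
    ∫ ω, ((pathEvent G p).indicator (fun _ => (1 : ℝ)) ω -
        (lpath volume (fun u v => ENNReal.ofReal (edgeProb w ρ u v)) k (ξ i ω)).toReal) *
      ((pathEvent G q).indicator (fun _ => (1 : ℝ)) ω -
        (lpath volume (fun u v => ENNReal.ofReal (edgeProb w ρ u v)) k (ξ i ω)).toReal) ∂μ
      = μ.real (pathEvent G p ∩ pathEvent G q) -
        (∫⁻ u, lpath volume (fun u v => ENNReal.ofReal (edgeProb w ρ u v)) k u ^ 2).toReal := by
  set K : I → I → ℝ≥0∞ := fun u v => ENNReal.ofReal (edgeProb w ρ u v) with hKdef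
  have hK : Measurable (Function.uncurry K) := (measurable_edgeProb hw ρ).ennreal_ofReal
  have hK1 : ∀ u v, K u v ≤ 1 := fun u v => by
    simpa [hKdef] using edgeProb_le_one (w := w) hρ u v
  set X : Ω → ℝ := fun ω => (lpath volume K k (ξ i ω)).toReal with hX
  have hXm : Measurable X :=
    ((measurable_lpath hK k).comp (hG.measurable_latent i)).ennreal_toReal
  have hX0 : ∀ ω, 0 ≤ X ω := fun ω => ENNReal.toReal_nonneg
  have hX1 : ∀ ω, X ω ≤ 1 := fun ω =>
    ENNReal.toReal_le_of_le_ofReal zero_le_one (by simpa using lpath_le_one hK1 k _)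
  have hXi : Integrable X μ := Integrable.of_bound hXm.aestronglyMeasurable 1
    (ae_of_all _ fun ω => by rw [Real.norm_of_nonneg (hX0 ω)]; exact hX1 ω)
  have hX2i : Integrable (fun ω => X ω ^ 2) μ :=
    Integrable.of_bound (hXm.pow_const 2).aestronglyMeasurable 1
    (ae_of_all _ fun ω => by
      rw [Real.norm_of_nonneg (sq_nonneg _)]; exact pow_le_one₀ (hX0 ω) (hX1 ω))
  have hXof : ∀ ω, ENNReal.ofReal (X ω) = lpath volume K k (ξ i ω) := fun ω =>
    ENNReal.ofReal_toReal (ne_top_of_le_ne_top ENNReal.one_ne_top (lpath_le_one hK1 k _))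
  have hcross : ∀ r ∈ paths k i, ∫ ω, (pathEvent G r).indicator X ω ∂μ
      = (∫⁻ u, lpath volume K k u ^ 2).toReal := by
    intro r hr
    obtain ⟨hrinj, hr0⟩ := mem_paths.1 hr
    rw [integral_indicator (hG.measurableSet_pathEvent r),
      integral_eq_lintegral_of_nonneg_ae (ae_of_all _ hX0) hXm.aestronglyMeasurable,
      ← hG.setLIntegral_pathEvent (measurable_edgeProb hw ρ) (edgeProb_nonneg hw0 hρ)
        (edgeProb_le_one hρ) (edgeProb_symm hsymm ρ) hrinj, hr0]
    simp_rw [hXof]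
    rfl
  have hX2 : ∫ ω, X ω ^ 2 ∂μ = (∫⁻ u, lpath volume K k u ^ 2).toReal := by
    rw [integral_eq_lintegral_of_nonneg_ae (ae_of_all _ fun ω => sq_nonneg _)
        (hXm.pow_const 2).aestronglyMeasurable,
      ← hG.lintegral_latent ((measurable_lpath hK k).pow_const 2) i]
    simp_rw [ENNReal.ofReal_pow (hX0 _), hXof]
  have hexp : ∀ ω, ((pathEvent G p).indicator (fun _ => (1 : ℝ)) ω - X ω) *
      ((pathEvent G q).indicator (fun _ => (1 : ℝ)) ω - X ω)
      = (pathEvent G p ∩ pathEvent G q).indicator (fun _ => (1 : ℝ)) ω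
        - (pathEvent G p).indicator X ω - (pathEvent G q).indicator X ω + X ω ^ 2 := by
    intro ω
    by_cases h1 : ω ∈ pathEvent G p <;> by_cases h2 : ω ∈ pathEvent G q <;>
      simp [h1, h2] <;> ring
  have hPm := hG.measurableSet_pathEvent p
  have hQm := hG.measurableSet_pathEvent q
  have hi1 : Integrable ((pathEvent G p ∩ pathEvent G q).indicator fun _ => (1 : ℝ)) μ :=
    (integrable_const 1).indicator (hPm.inter hQm)
  refine (integral_congr_ae (ae_of_all _ hexp)).trans ?_
  have hi2 : Integrable (fun ω => (pathEvent G p ∩ pathEvent G q).indicator (fun _ => (1 : ℝ)) ω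
      - (pathEvent G p).indicator X ω) μ := hi1.sub (hXi.indicator hPm)
  have hi3 : Integrable (fun ω => (pathEvent G p ∩ pathEvent G q).indicator (fun _ => (1 : ℝ)) ω
      - (pathEvent G p).indicator X ω - (pathEvent G q).indicator X ω) μ :=
    hi2.sub (hXi.indicator hQm)
  rw [integral_add hi3 hX2i, integral_sub hi2 (hXi.indicator hQm),
    integral_sub hi1 (hXi.indicator hPm), hcross p hp, hcross q hq, hX2,
    integral_indicator (hPm.inter hQm)]
  simp

/-- The path counts `D_i^(k)` concentrate around their conditional means given `ξ i`. -/
theorem integral_pathDegree_sub_sq_le (hρ : 0 < ρ) (hG : IsLatentGraph μ (edgeProb w ρ) ξ G)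
    (hw : Measurable (Function.uncurry w)) (hw0 : ∀ u v, 0 ≤ w u v)
    (hsymm : ∀ u v, w u v = w v u) {k m : ℕ} (hk : k ≠ 0) (hkm : k ≤ m)
    (hfin : momentBound volume (fun u v => ENNReal.ofReal (w u v)) m ≠ ∞) (i : Fin n) :
    ∫ ω, ((pathDegree (G ω) k i : ℝ) - (n - 1).descFactorial k *
        (lpath volume (fun u v => ENNReal.ofReal (edgeProb w ρ u v)) k (ξ i ω)).toReal) ^ 2 ∂μ
      ≤ (momentBound volume (fun u v => ENNReal.ofReal (w u v)) m).toReal *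
        (((n - 1) * ρ) ^ k * (k * ((k + 1) * (k + 1 + (n - 1) * ρ) ^ (k - 1)))) := by
  classical
  set C := (momentBound volume (fun u v => ENNReal.ofReal (w u v)) m).toReal with hC
  set X : Ω → ℝ := fun ω =>
    (lpath volume (fun u v => ENNReal.ofReal (edgeProb w ρ u v)) k (ξ i ω)).toReal with hX
  set y : (Fin (k + 1) → Fin n) → Ω → ℝ := fun p ω =>
    (pathEvent G p).indicator (fun _ => (1 : ℝ)) ω with hy
  set v : ℝ := (∫⁻ u, lpath volume (fun u v => ENNReal.ofReal (edgeProb w ρ u v)) k u ^ 2).toReal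
    with hv
  have hn : 1 ≤ n := by have := i.isLt; omega
  have hn' : (0 : ℝ) ≤ n - 1 := by rw [sub_nonneg]; exact_mod_cast hn
  have hexp : ∀ ω, ((pathDegree (G ω) k i : ℝ) - (n - 1).descFactorial k * X ω) ^ 2
      = ∑ p ∈ paths k i, ∑ q ∈ paths k i, (y p ω - X ω) * (y q ω - X ω) := by
    intro ω
    rw [pathDegree_eq_sum, ← card_paths k i, ← nsmul_eq_mul, ← Finset.sum_const,
      ← Finset.sum_sub_distrib, sq, Finset.sum_mul_sum]
  have hint : ∀ p q, Integrable (fun ω => (y p ω - X ω) * (y q ω - X ω)) μ := fun p q =>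
    ((hG.memLp_indicator_pathEvent_sub hρ hw k i p).mono_exponent (p := 2) le_top).integrable_mul
      ((hG.memLp_indicator_pathEvent_sub hρ hw k i q).mono_exponent (p := 2) le_top)
  have hterm : ∀ p ∈ paths k i, ∑ q ∈ paths k i, ∫ ω, (y p ω - X ω) * (y q ω - X ω) ∂μ
      ≤ C * (ρ ^ k * (k * ((k + 1) * (k + 1 + (n - 1) * ρ) ^ (k - 1)))) := by
    intro p hp
    obtain ⟨hpinj, hp0⟩ := mem_paths.1 hp
    calc _ = ∑ q ∈ paths k i, (μ.real (pathEvent G p ∩ pathEvent G q) - v) :=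
          Finset.sum_congr rfl fun q hq =>
            hG.integral_pathEvent_sub_mul hρ hw hw0 hsymm hp hq
      -- Disjoint pairs contribute exactly zero. For overlapping pairs the subtracted second moment
      -- is simply dropped.
      _ ≤ ∑ q ∈ paths k i, (if ∃ (j : Fin k) (l : Fin (k + 1)), q j.succ = p l then
            C * ρ ^ (k + (Finset.univ.filter fun j : Fin k => ∀ l, q j.succ ≠ p l).card)
            else 0) := by
          refine Finset.sum_le_sum fun q hq => ?_
          obtain ⟨hqinj, hq0⟩ := mem_paths.1 hq
          split_ifs with hov
          · refine (sub_le_self _ ENNReal.toReal_nonneg).trans ?_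
            have h1 := hG.measure_pathEvent_inter_le hρ hw hw0 hsymm hk hkm hpinj hqinj
              (J := Finset.univ.filter fun j : Fin k => ∀ l, q j.succ ≠ p l)
              (fun j hj => (Finset.mem_filter.1 hj).2)
            have h2 := ENNReal.toReal_mono
              (ENNReal.mul_ne_top (ENNReal.pow_ne_top ENNReal.ofReal_ne_top) hfin) h1
            rw [ENNReal.toReal_mul, ENNReal.toReal_pow, ENNReal.toReal_ofReal hρ.le, mul_comm] at h2
            exact h2
          · push Not at hov
            rw [measureReal_def, hG.measure_pathEvent_inter_of_disjoint (measurable_edgeProb hw ρ)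
              (edgeProb_nonneg hw0 hρ) (edgeProb_le_one hρ) (edgeProb_symm hsymm ρ) hpinj hqinj
              (hp0.trans hq0.symm) hov, sub_self]
      _ = C * ∑ q ∈ paths k i with ∃ (j : Fin k) (l : Fin (k + 1)), q j.succ = p l,
            ρ ^ (k + (Finset.univ.filter fun j : Fin k => ∀ l, q j.succ ≠ p l).card) := by
          rw [Finset.mul_sum, Finset.sum_filter]
      _ ≤ _ := mul_le_mul_of_nonneg_left (sum_overlap_le hρ.le i p) ENNReal.toReal_nonneg
  calc _ = ∑ p ∈ paths k i, ∑ q ∈ paths k i, ∫ ω, (y p ω - X ω) * (y q ω - X ω) ∂μ := by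
        refine (integral_congr_ae (ae_of_all _ hexp)).trans ?_
        rw [integral_finsetSum _ fun p _ => integrable_finsetSum _ fun q _ => hint p q]
        exact Finset.sum_congr rfl fun p _ => integral_finsetSum _ fun q _ => hint p q
    _ ≤ (paths k i).card • (C * (ρ ^ k * (k * ((k + 1) * (k + 1 + (n - 1) * ρ) ^ (k - 1))))) :=
        Finset.sum_le_card_nsmul _ _ _ hterm
    _ ≤ ((n : ℝ) - 1) ^ k * (C * (ρ ^ k * (k * ((k + 1) * (k + 1 + (n - 1) * ρ) ^ (k - 1))))) := by
        rw [nsmul_eq_mul, card_paths]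
        refine mul_le_mul_of_nonneg_right ?_ (by positivity)
        have h1 : (((n - 1).descFactorial k : ℕ) : ℝ) ≤ ((n - 1 : ℕ) : ℝ) ^ k := by
          exact_mod_cast Nat.descFactorial_le_pow _ _
        rwa [Nat.cast_sub hn, Nat.cast_one] at h1
    _ = _ := by rw [mul_pow]; ring

end IsLatentGraph

end Variance

/-! ### Calculus of convergence to zero in probability -/

section Vanish

variable {Ω : ℕ → Type*} [∀ n, MeasurableSpace (Ω n)] {μ : ∀ n, Measure (Ω n)}

/-- The nonnegative quantities `Z n` tend to `0` in probability. -/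
def Vanish (μ : ∀ n, Measure (Ω n)) (Z : ∀ n, Ω n → ℝ) : Prop :=
  ∀ ε : ℝ, 0 < ε → Tendsto (fun n => μ n {ω | ε ≤ Z n ω}) atTop (𝓝 0)

namespace Vanish

lemma of_subset {Z : ∀ n, Ω n → ℝ} (hZ : Vanish μ Z) {A : ∀ n, Set (Ω n)} {ε : ℝ} (hε : 0 < ε)
    (hA : ∀ᶠ n in atTop, A n ⊆ {ω | ε ≤ Z n ω}) : Tendsto (fun n => μ n (A n)) atTop (𝓝 0) :=
  tendsto_of_tendsto_of_tendsto_of_le_of_le' tendsto_const_nhds (hZ ε hε)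
    (Eventually.of_forall fun _ => zero_le) (hA.mono fun _ h => measure_mono h)

lemma mono {Z Y : ∀ n, Ω n → ℝ} (hZ : Vanish μ Z) (h : ∀ᶠ n in atTop, ∀ ω, Y n ω ≤ Z n ω) :
    Vanish μ Y := fun _ hε =>
  hZ.of_subset hε (h.mono fun _ hn ω hω => le_trans hω (hn ω))

lemma add {Z Y : ∀ n, Ω n → ℝ} (hZ : Vanish μ Z) (hY : Vanish μ Y) :
    Vanish μ fun n ω => Z n ω + Y n ω := fun ε hε => by
  have h := (hZ (ε / 2) (half_pos hε)).add (hY (ε / 2) (half_pos hε))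
  rw [add_zero] at h
  refine tendsto_of_tendsto_of_tendsto_of_le_of_le tendsto_const_nhds h (fun _ => zero_le)
    fun n => (measure_mono fun ω hω => ?_).trans (measure_union_le _ _)
  simp only [Set.mem_ofPred_eq, Set.mem_union] at hω ⊢
  by_contra! hcon
  linarith [hcon.1, hcon.2]

lemma zero : Vanish μ fun _ _ => 0 := fun ε hε => by
  simp [hε.not_ge]

lemma sum {ι : Type*} (s : Finset ι) {Z : ι → ∀ n, Ω n → ℝ} (hZ : ∀ i ∈ s, Vanish μ (Z i)) :
    Vanish μ fun n ω => ∑ i ∈ s, Z i n ω := by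
  classical
  induction s using Finset.induction_on with
  | empty => simpa using zero
  | insert a s ha ih =>
    simp only [Finset.sum_insert ha]
    exact (hZ a (Finset.mem_insert_self _ _)).add
      (ih fun i hi => hZ i (Finset.mem_insert_of_mem hi))

lemma const_mul {Z : ∀ n, Ω n → ℝ} (hZ : Vanish μ Z) {c : ℝ} (hc : 0 < c) :
    Vanish μ fun n ω => c * Z n ω := fun ε hε =>
  hZ.of_subset (div_pos hε hc) (Eventually.of_forall fun n ω hω => by
    simp only [Set.mem_ofPred_eq] at hω ⊢
    rwa [div_le_iff₀' hc])

/-- Continuous mapping at a constant limit. Continuity at `c` alone suffices, so inversion at `1` is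
covered although the average degree may vanish. -/
lemma sq_sub_of_continuousAt {d : ∀ n, Ω n → ℝ} {c : ℝ} (hd : Vanish μ fun n ω => (d n ω - c) ^ 2)
    {f : ℝ → ℝ} (hf : ContinuousAt f c) : Vanish μ fun n ω => (f (d n ω) - f c) ^ 2 := by
  intro ε hε
  obtain ⟨δ, hδ, h⟩ := Metric.continuousAt_iff.1 hf (Real.sqrt ε) (Real.sqrt_pos.2 hε)
  refine hd.of_subset (pow_pos hδ 2) (Eventually.of_forall fun n ω hω => ?_)
  simp only [Set.mem_ofPred_eq] at hω ⊢
  by_contra! hcon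
  have h1 := h (x := d n ω) (by
    rw [Real.dist_eq]; exact abs_lt_of_sq_lt_sq hcon hδ.le)
  rw [Real.dist_eq, Real.lt_sqrt (abs_nonneg _), sq_abs] at h1
  exact absurd hω h1.not_ge

lemma of_lintegral {Z : ∀ n, Ω n → ℝ} (hm : ∀ n, Measurable (Z n))
    (hZ : Tendsto (fun n => ∫⁻ ω, ENNReal.ofReal (Z n ω) ∂μ n) atTop (𝓝 0)) : Vanish μ Z := by
  intro ε hε
  have hε' : ENNReal.ofReal ε ≠ 0 := by simpa using hε
  have h := ENNReal.Tendsto.div_const hZ (Or.inr hε')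
  rw [ENNReal.zero_div] at h
  refine tendsto_of_tendsto_of_tendsto_of_le_of_le tendsto_const_nhds h (fun _ => zero_le)
    fun n => (measure_mono fun ω hω => ?_).trans
      (meas_ge_le_lintegral_div (hm n).ennreal_ofReal.aemeasurable hε' ENNReal.ofReal_ne_top)
  exact ENNReal.ofReal_le_ofReal hω

/-- A vanishing factor times a factor bounded in mean vanishes. -/
lemma mul_of_lintegral_le {Z Q : ∀ n, Ω n → ℝ} (hZ : Vanish μ Z) (hQm : ∀ n, Measurable (Q n))
    (hQ0 : ∀ n ω, 0 ≤ Q n ω) {C : ℝ≥0∞} (hC : C ≠ ∞)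
    (hQ : ∀ᶠ n in atTop, ∫⁻ ω, ENNReal.ofReal (Q n ω) ∂μ n ≤ C) :
    Vanish μ fun n ω => Z n ω * Q n ω := by
  intro ε hε
  rw [ENNReal.tendsto_nhds_zero]
  intro η hη
  -- By Markov's inequality `Q n ≥ M` has probability at most `C / M`; off this event, `Z n * Q n ≥
  -- ε` forces `Z n ≥ ε / M`.
  obtain ⟨M, hM0, hM⟩ : ∃ M : ℝ, 0 < M ∧ C / ENNReal.ofReal M ≤ η / 2 := by
    have h1 : Tendsto (fun M : ℝ => C / ENNReal.ofReal M) atTop (𝓝 0) := by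
      have := ENNReal.Tendsto.const_div (a := C) ENNReal.tendsto_ofReal_atTop (Or.inr hC)
      simpa using this
    have h2 := (h1.eventually (ge_mem_nhds (ENNReal.half_pos hη.ne'))).and
      (eventually_gt_atTop (0 : ℝ))
    obtain ⟨M, h3, h4⟩ := h2.exists
    exact ⟨M, h4, h3⟩
  have hM' : ENNReal.ofReal M ≠ 0 := by simpa using hM0
  filter_upwards [hQ, (ENNReal.tendsto_nhds_zero.1 (hZ (ε / M) (div_pos hε hM0))) (η / 2)
    (ENNReal.half_pos hη.ne')] with n hn1 hn2
  calc μ n {ω | ε ≤ Z n ω * Q n ω}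
      ≤ μ n ({ω | ε / M ≤ Z n ω} ∪ {ω | ENNReal.ofReal M ≤ ENNReal.ofReal (Q n ω)}) := by
        refine measure_mono fun ω hω => ?_
        simp only [Set.mem_ofPred_eq, Set.mem_union] at hω ⊢
        by_contra! hcon
        obtain ⟨h1, h2⟩ := hcon
        have h3 : Q n ω < M := (ENNReal.ofReal_lt_ofReal_iff hM0).1 h2
        rw [lt_div_iff₀ hM0] at h1
        rcases le_total (Z n ω) 0 with h | h
        · have := mul_nonneg (neg_nonneg.2 h) (hQ0 n ω)
          linarith
        · have := mul_le_mul_of_nonneg_left h3.le h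
          linarith
    _ ≤ η / 2 + η / 2 := by
        refine (measure_union_le _ _).trans (add_le_add hn2 ?_)
        refine (meas_ge_le_lintegral_div (hQm n).ennreal_ofReal.aemeasurable hM'
          ENNReal.ofReal_ne_top).trans ((ENNReal.div_le_div_right hn1 _).trans hM)
    _ = η := ENNReal.add_halves η

end Vanish

end Vanish

/-! ### Weak law of large numbers for functions of the latent variables -/

section LawOfLargeNumbers

variable {Ω : ℕ → Type*} [∀ n, MeasurableSpace (Ω n)] {μ : ∀ n, Measure (Ω n)}
  [∀ n, IsProbabilityMeasure (μ n)] {h : ℕ → I → I → ℝ} {ξ : ∀ n, Fin n → Ω n → I}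
  {G : ∀ n, Ω n → SimpleGraph (Fin n)}

/-- Chebyshev's inequality: independence makes the variance of the average `Var[f] / n`. The
threshold is `√ε` because the deviation is squared. -/
lemma vanish_average_sub_integral (hG : ∀ n, IsLatentGraph (μ n) (h n) (ξ n) (G n)) {f : I → ℝ}
    (hfm : Measurable f) (hf : MemLp f 2 (volume : Measure I)) :
    Vanish μ fun n ω => ((∑ i, f (ξ n i ω)) / n - ∫ u, f u) ^ 2 := by
  intro ε hε
  have hmp : ∀ n i, MeasurePreserving (ξ n i) (μ n) volume := fun n i =>
    ⟨(hG n).measurable_latent i, (hG n).uniform_latent i⟩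
  have hfi : ∀ n i, MemLp (fun ω => f (ξ n i ω)) 2 (μ n) := fun n i =>
    hf.comp_measurePreserving (hmp n i)
  have hmean : ∀ n : ℕ, 0 < n → ∫ ω, (n : ℝ)⁻¹ * (∑ i, fun ω => f (ξ n i ω)) ω ∂μ n = ∫ u, f u := by
    intro n hn
    rw [integral_const_mul]
    simp only [Finset.sum_apply]
    rw [integral_finsetSum _ fun i _ => (hfi n i).integrable one_le_two]
    have : ∀ i, ∫ ω, f (ξ n i ω) ∂μ n = ∫ u, f u := fun i => by
      rw [← (hG n).uniform_latent i, integral_map ((hG n).measurable_latent i).aemeasurable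
        hfm.aestronglyMeasurable]
    simp only [this, Finset.sum_const, Finset.card_univ, Fintype.card_fin, nsmul_eq_mul]
    field_simp
  have hvar : ∀ n : ℕ, 0 < n → Var[fun ω => (n : ℝ)⁻¹ * (∑ i, fun ω => f (ξ n i ω)) ω; μ n]
      = Var[f; volume] / n := by
    intro n hn
    rw [variance_const_mul, IndepFun.variance_sum (fun i _ => hfi n i)]
    · have : ∀ i, Var[fun ω => f (ξ n i ω); μ n] = Var[f; volume] := fun i => by
        rw [← (hG n).uniform_latent i, variance_map hfm.aemeasurable
          ((hG n).measurable_latent i).aemeasurable]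
        rfl
      simp only [this, Finset.sum_const, Finset.card_univ, Fintype.card_fin, nsmul_eq_mul]
      field_simp
    · intro i _ j _ hij
      exact ((hG n).indep_latent.indepFun hij).comp hfm hfm
  have hlim : Tendsto (fun n : ℕ => ENNReal.ofReal (Var[f; volume] / n / Real.sqrt ε ^ 2)) atTop
      (𝓝 0) := by
    rw [← ENNReal.ofReal_zero]
    refine (ENNReal.continuous_ofReal.tendsto 0).comp ?_
    have := (tendsto_const_div_atTop_nhds_zero_nat Var[f; volume]).div_const (Real.sqrt ε ^ 2)
    simpa using this
  refine tendsto_of_tendsto_of_tendsto_of_le_of_le' tendsto_const_nhds hlim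
    (Eventually.of_forall fun _ => zero_le) ?_
  filter_upwards [eventually_gt_atTop 0] with n hn
  have hL : MemLp (fun ω => (n : ℝ)⁻¹ * (∑ i, fun ω => f (ξ n i ω)) ω) 2 (μ n) :=
    (memLp_finsetSum' _ fun i _ => hfi n i).const_mul _
  rw [← hvar n hn]
  refine (measure_mono fun ω hω => ?_).trans
    (meas_ge_le_variance_div_sq hL (Real.sqrt_pos.2 hε))
  simp only [Set.mem_ofPred_eq] at hω ⊢
  rw [hmean n hn, ← Real.sqrt_sq_eq_abs]
  refine Real.sqrt_le_sqrt ?_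
  rw [Finset.sum_apply, inv_mul_eq_div]
  exact hω

end LawOfLargeNumbers

/-! ### Real-valued path means and removal of the truncation -/

section PathMean

/-- The function `T_w ^ k 1`. -/
noncomputable def pathMean (w : I → I → ℝ) (k : ℕ) (u : I) : ℝ :=
  (lpath volume (fun u v => ENNReal.ofReal (w u v)) k u).toReal

variable {w : I → I → ℝ}

lemma measurable_pathMean (hw : Measurable (Function.uncurry w)) (k : ℕ) :
    Measurable (pathMean w k) :=
  (measurable_lpath (K := fun u v => ENNReal.ofReal (w u v)) hw.ennreal_ofReal k).ennreal_toReal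

lemma pathMean_nonneg (k : ℕ) (u : I) : 0 ≤ pathMean w k u := ENNReal.toReal_nonneg

lemma pathMean_edgeProb {ρ : ℝ} (hρ : 0 < ρ) (k : ℕ) (u : I) :
    pathMean (edgeProb w ρ) k u = ρ ^ k * pathMean (truncKernel w ρ) k u := by
  unfold pathMean
  have h := lpath_const_mul (ν := volume) (K := fun u v => ENNReal.ofReal (truncKernel w ρ u v))
    (c := ENNReal.ofReal ρ) ENNReal.ofReal_ne_top k u
  simp only [← ENNReal.ofReal_mul hρ.le] at h
  have h2 : (fun u v => ENNReal.ofReal (edgeProb w ρ u v))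
      = fun u v => ENNReal.ofReal (ρ * truncKernel w ρ u v) := rfl
  rw [h2, h, ENNReal.toReal_mul, ENNReal.toReal_pow, ENNReal.toReal_ofReal hρ.le]

lemma lintegral_pathMean_sq_le (hw : Measurable (Function.uncurry w))
    (hsymm : ∀ u v, w u v = w v u) {k m : ℕ} (hk : k ≠ 0) (hkm : k ≤ m) :
    ∫⁻ u, ENNReal.ofReal (pathMean w k u ^ 2)
      ≤ momentBound volume (fun u v => ENNReal.ofReal (w u v)) m := by
  refine le_trans (lintegral_mono fun u => ?_)
    (lintegral_lpath_sq_le hw.ennreal_ofReal (fun u v => by rw [hsymm]) hk hkm)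
  rw [ENNReal.ofReal_pow (pathMean_nonneg k u)]
  exact pow_le_pow_left' ENNReal.ofReal_toReal_le 2

lemma memLp_pathMean (hw : Measurable (Function.uncurry w))
    (hsymm : ∀ u v, w u v = w v u) {k m : ℕ} (hk : k ≠ 0) (hkm : k ≤ m)
    (hfin : momentBound volume (fun u v => ENNReal.ofReal (w u v)) m ≠ ∞) :
    MemLp (pathMean w k) 2 (volume : Measure I) := by
  rw [memLp_two_iff_integrable_sq (measurable_pathMean hw k).aestronglyMeasurable]
  refine ⟨((measurable_pathMean hw k).pow_const 2).aestronglyMeasurable, ?_⟩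
  rw [hasFiniteIntegral_iff_ofReal (ae_of_all _ fun u => sq_nonneg _)]
  exact (lintegral_pathMean_sq_le hw hsymm hk hkm).trans_lt hfin.lt_top

lemma tendsto_lintegral_pathMean_sub_sq (hw : Measurable (Function.uncurry w))
    (hw0 : ∀ u v, 0 ≤ w u v) (hsymm : ∀ u v, w u v = w v u) {k m : ℕ} (hk : k ≠ 0) (hkm : k ≤ m)
    (hfin : momentBound volume (fun u v => ENNReal.ofReal (w u v)) m ≠ ∞) {ρ : ℕ → ℝ}
    (hρ : Tendsto
      (fun n => eLpNorm (fun p : I × I => truncKernel w (ρ n) p.1 p.2 - w p.1 p.2) 2 volume)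
      atTop (𝓝 0)) :
    Tendsto (fun n => ∫⁻ u, ENNReal.ofReal ((pathMean (truncKernel w (ρ n)) k u
      - pathMean w k u) ^ 2)) atTop (𝓝 0) := by
  have hK : Measurable (Function.uncurry fun u v => ENNReal.ofReal (w u v)) := hw.ennreal_ofReal
  have hle : ∀ n u v, ENNReal.ofReal (truncKernel w (ρ n) u v) ≤ ENNReal.ofReal (w u v) :=
    fun n u v => ENNReal.ofReal_le_ofReal (truncKernel_le hw0 _ u v)
  have hae : ∀ j ≤ k, ∀ᵐ u : I, lpath volume (fun u v => ENNReal.ofReal (w u v)) j u ≠ ∞ :=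
    fun j hj => ae_lpath_ne_top hK (fun u v => by rw [hsymm]) (hj.trans hkm) hfin
  have h := tendsto_lintegral_lpath_sub_sq (ν := volume) hK
    (L := fun n u v => ENNReal.ofReal (truncKernel w (ρ n) u v))
    (fun n => (measurable_truncKernel hw (ρ n)).ennreal_ofReal) hle
    (fun u v => ENNReal.ofReal_ne_top) (exists_subseq_ae_tendsto_truncKernel hw hρ) k hae
    (ne_top_of_le_ne_top hfin (lintegral_lpath_sq_le hK (fun u v => by rw [hsymm]) hk hkm))
  refine h.congr fun n => lintegral_congr_ae ?_
  filter_upwards [hae k le_rfl] with u hu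
  have hle' := lpath_mono (ν := volume) (hle n) k u
  change (_ : ℝ≥0∞) = ENNReal.ofReal (((lpath volume
    (fun u v => ENNReal.ofReal (truncKernel w (ρ n) u v)) k u).toReal -
    (lpath volume (fun u v => ENNReal.ofReal (w u v)) k u).toReal) ^ 2)
  -- Truncated subtraction in `[0, ∞]` agrees with real subtraction here: the truncated path mean is
  -- the smaller one and both are finite.
  rw [← sq_abs, abs_sub_comm, abs_of_nonneg (sub_nonneg.2 (ENNReal.toReal_mono hu hle')),
    ENNReal.ofReal_pow (sub_nonneg.2 (ENNReal.toReal_mono hu hle')),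
    ENNReal.ofReal_sub _ ENNReal.toReal_nonneg, ENNReal.ofReal_toReal hu, ENNReal.ofReal_toReal (ne_top_of_le_ne_top hu hle')]

end PathMean

/-! ### Mean square error of the path counts scaled by `(n - 1) ρ` -/

section MeanSquare

variable {Ω : Type*} [MeasurableSpace Ω] {μ : Measure Ω} {n : ℕ}
  {w : I → I → ℝ} {ρ : ℝ} {h : I → I → ℝ} {ξ : Fin n → Ω → I} {G : Ω → SimpleGraph (Fin n)}

namespace IsLatentGraph

lemma measurable_pathDegree (hG : IsLatentGraph μ h ξ G) (k : ℕ) (i : Fin n) :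
    Measurable fun ω => (pathDegree (G ω) k i : ℝ) := by
  simp_rw [pathDegree_eq_sum]
  exact Finset.measurable_sum _ fun p _ =>
    measurable_const.indicator (hG.measurableSet_pathEvent p)

end IsLatentGraph

/-- A bound for the mean square error of `D_i^(k) / λ ^ k`. -/
noncomputable def pathDegreeError (w : I → I → ℝ) (m k n : ℕ) (ρ : ℝ) : ℝ≥0∞ :=
  3 * (ENNReal.ofReal ((momentBound volume (fun u v => ENNReal.ofReal (w u v)) m).toReal *
      (((n - 1) * ρ) ^ k * (k * ((k + 1) * (k + 1 + (n - 1) * ρ) ^ (k - 1)))) /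
        (((n - 1) * ρ) ^ k) ^ 2) +
    (∫⁻ u, ENNReal.ofReal ((pathMean (truncKernel w ρ) k u - pathMean w k u) ^ 2)) +
    ENNReal.ofReal ((((n - 1).descFactorial k : ℝ) / ((n : ℝ) - 1) ^ k - 1) ^ 2) *
      momentBound volume (fun u v => ENNReal.ofReal (w u v)) m)

/-- The error has three sources: fluctuation around the conditional mean, truncation of the kernel,
and the ratio `c ≤ 1` of the number of self-avoiding paths to `(n - 1) ^ k`. The factor `3` comes
from squaring a sum of three terms. -/
lemma IsLatentGraph.lintegral_pathDegree_sub_sq_le [IsProbabilityMeasure μ] (hρ : 0 < ρ)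
    (hG : IsLatentGraph μ (edgeProb w ρ) ξ G)
    (hw : Measurable (Function.uncurry w)) (hw0 : ∀ u v, 0 ≤ w u v)
    (hsymm : ∀ u v, w u v = w v u) {k m : ℕ} (hk : k ≠ 0) (hkm : k ≤ m)
    (hfin : momentBound volume (fun u v => ENNReal.ofReal (w u v)) m ≠ ∞) (hn : 2 ≤ n)
    (i : Fin n) :
    ∫⁻ ω, ENNReal.ofReal (((pathDegree (G ω) k i : ℝ) / ((n - 1) * ρ) ^ k
      - pathMean w k (ξ i ω)) ^ 2) ∂μ ≤ pathDegreeError w m k n ρ := by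
  have hn0 : (0 : ℝ) < n - 1 := by
    have : (2 : ℝ) ≤ n := by exact_mod_cast hn
    linarith
  set lam : ℝ := (n - 1) * ρ with hlam
  have hlam0 : 0 < lam := mul_pos hn0 hρ
  set N : ℝ := ((n - 1).descFactorial k : ℝ) with hN
  set c : ℝ := N / ((n : ℝ) - 1) ^ k with hc
  have hc0 : 0 ≤ c := by positivity
  have hc1 : c ≤ 1 := by
    rw [hc, div_le_one (pow_pos hn0 k)]
    have h1 : (((n - 1).descFactorial k : ℕ) : ℝ) ≤ ((n - 1 : ℕ) : ℝ) ^ k := by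
      exact_mod_cast Nat.descFactorial_le_pow _ _
    rwa [Nat.cast_sub (by omega), Nat.cast_one] at h1
  set D : Ω → ℝ := fun ω => (pathDegree (G ω) k i : ℝ) with hD
  set X : Ω → ℝ := fun ω => pathMean (edgeProb w ρ) k (ξ i ω) with hX
  have hDm : Measurable D := hG.measurable_pathDegree k i
  have hXm : Measurable X :=
    (measurable_pathMean (measurable_edgeProb hw ρ) k).comp (hG.measurable_latent i)
  have hpt : ∀ ω, (D ω / lam ^ k - pathMean w k (ξ i ω)) ^ 2 ≤
      3 * ((D ω - N * X ω) ^ 2 / (lam ^ k) ^ 2 +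
        (pathMean (truncKernel w ρ) k (ξ i ω) - pathMean w k (ξ i ω)) ^ 2 +
        (c - 1) ^ 2 * pathMean w k (ξ i ω) ^ 2) := by
    intro ω
    set φ := pathMean w k (ξ i ω)
    set ψ := pathMean (truncKernel w ρ) k (ξ i ω) with hψ
    have h1 : N * X ω / lam ^ k = c * ψ := by
      simp only [hX]
      rw [pathMean_edgeProb hρ, hc, hlam, mul_pow, ← hψ]
      have := hn0.ne'
      field_simp
    have h2 : D ω / lam ^ k - φ
        = (D ω - N * X ω) / lam ^ k + c * (ψ - φ) + (c - 1) * φ := by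
      rw [sub_div, h1]; ring
    rw [h2, ← div_pow, ← mul_pow]
    have h3 : (c * (ψ - φ)) ^ 2 ≤ (ψ - φ) ^ 2 := by
      rw [mul_pow]
      exact mul_le_of_le_one_left (sq_nonneg _) (pow_le_one₀ hc0 hc1)
    nlinarith [sq_nonneg ((D ω - N * X ω) / lam ^ k - c * (ψ - φ)),
      sq_nonneg ((D ω - N * X ω) / lam ^ k - (c - 1) * φ),
      sq_nonneg (c * (ψ - φ) - (c - 1) * φ)]
  have hφm : Measurable fun u => ENNReal.ofReal (pathMean w k u ^ 2) :=
    ((measurable_pathMean hw k).pow_const 2).ennreal_ofReal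
  have hψm : Measurable fun u =>
      ENNReal.ofReal ((pathMean (truncKernel w ρ) k u - pathMean w k u) ^ 2) :=
    (((measurable_pathMean (measurable_truncKernel hw ρ) k).sub
      (measurable_pathMean hw k)).pow_const 2).ennreal_ofReal
  have hDXm : Measurable fun ω => (D ω - N * X ω) ^ 2 / (lam ^ k) ^ 2 :=
    ((hDm.sub (hXm.const_mul N)).pow_const 2).div_const _
  have hvar : ∫⁻ ω, ENNReal.ofReal ((D ω - N * X ω) ^ 2 / (lam ^ k) ^ 2) ∂μ ≤
      ENNReal.ofReal ((momentBound volume (fun u v => ENNReal.ofReal (w u v)) m).toReal *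
        (lam ^ k * (k * ((k + 1) * (k + 1 + lam) ^ (k - 1)))) / (lam ^ k) ^ 2) := by
    have hbd : ∀ ω, (D ω - N * X ω) ^ 2 = ∑ p ∈ paths k i, ∑ q ∈ paths k i,
        ((pathEvent G p).indicator (fun _ => (1 : ℝ)) ω - X ω) *
        ((pathEvent G q).indicator (fun _ => (1 : ℝ)) ω - X ω) := by
      intro ω
      simp only [hD, hN]
      rw [pathDegree_eq_sum, ← card_paths k i, ← nsmul_eq_mul, ← Finset.sum_const,
        ← Finset.sum_sub_distrib, sq, Finset.sum_mul_sum]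
    have hint : Integrable (fun ω => (D ω - N * X ω) ^ 2) μ := by
      simp_rw [hbd]
      exact integrable_finsetSum _ fun p _ => integrable_finsetSum _ fun q _ =>
        ((hG.memLp_indicator_pathEvent_sub hρ hw k i p).mono_exponent (p := 2) le_top).integrable_mul
        ((hG.memLp_indicator_pathEvent_sub hρ hw k i q).mono_exponent (p := 2) le_top)
    rw [← ofReal_integral_eq_lintegral_ofReal (hint.div_const _)
      (ae_of_all _ fun ω => by positivity), integral_div]
    refine ENNReal.ofReal_le_ofReal (div_le_div_of_nonneg_right ?_ (by positivity))
    exact hG.integral_pathDegree_sub_sq_le hρ hw hw0 hsymm hk hkm hfin i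
  calc _ ≤ ∫⁻ ω, 3 * (ENNReal.ofReal ((D ω - N * X ω) ^ 2 / (lam ^ k) ^ 2) +
        ENNReal.ofReal ((pathMean (truncKernel w ρ) k (ξ i ω) - pathMean w k (ξ i ω)) ^ 2) +
        ENNReal.ofReal ((c - 1) ^ 2) * ENNReal.ofReal (pathMean w k (ξ i ω) ^ 2)) ∂μ := by
        refine lintegral_mono fun ω => (ENNReal.ofReal_le_ofReal (hpt ω)).trans_eq ?_
        rw [ENNReal.ofReal_mul (by norm_num), ENNReal.ofReal_add (by positivity) (by positivity),
          ENNReal.ofReal_add (by positivity) (by positivity), ENNReal.ofReal_mul (sq_nonneg _)]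
        simp
    _ = 3 * (∫⁻ ω, ENNReal.ofReal ((D ω - N * X ω) ^ 2 / (lam ^ k) ^ 2) ∂μ +
        (∫⁻ u, ENNReal.ofReal ((pathMean (truncKernel w ρ) k u - pathMean w k u) ^ 2)) +
        ENNReal.ofReal ((c - 1) ^ 2) * ∫⁻ u, ENNReal.ofReal (pathMean w k u ^ 2)) := by
        have hmi := hG.measurable_latent i
        have hφi : Measurable fun ω => ENNReal.ofReal (pathMean w k (ξ i ω) ^ 2) := hφm.comp hmi
        have hψi : Measurable fun ω => ENNReal.ofReal
          ((pathMean (truncKernel w ρ) k (ξ i ω) - pathMean w k (ξ i ω)) ^ 2) := hψm.comp hmi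
        rw [lintegral_const_mul' _ _ (by simp), lintegral_add_right _
          (hφi.const_mul _), lintegral_add_right _ hψi, lintegral_const_mul _ hφi, ← hG.lintegral_latent hφm i,
          ← hG.lintegral_latent hψm i]
    _ ≤ _ := by
        unfold pathDegreeError
        gcongr
        exact lintegral_pathMean_sq_le hw hsymm hk hkm

lemma tendsto_pathDegreeError (hw : Measurable (Function.uncurry w))
    (hw0 : ∀ u v, 0 ≤ w u v) (hsymm : ∀ u v, w u v = w v u) {k m : ℕ} (hk : k ≠ 0) (hkm : k ≤ m)
    (hfin : momentBound volume (fun u v => ENNReal.ofReal (w u v)) m ≠ ∞) {ρ : ℕ → ℝ}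
    (hρ : Tendsto
      (fun n => eLpNorm (fun p : I × I => truncKernel w (ρ n) p.1 p.2 - w p.1 p.2) 2 volume)
      atTop (𝓝 0))
    (hdeg : Tendsto (fun n : ℕ => ((n : ℝ) - 1) * ρ n) atTop atTop) :
    Tendsto (fun n => pathDegreeError w m k n (ρ n)) atTop (𝓝 0) := by
  have h2 := tendsto_lintegral_pathMean_sub_sq hw hw0 hsymm hk hkm hfin hρ
  set C := (momentBound volume (fun u v => ENNReal.ofReal (w u v)) m).toReal with hC
  have h1 : Tendsto (fun n : ℕ => C *
      ((((n : ℝ) - 1) * ρ n) ^ k * (k * ((k + 1) * (k + 1 + ((n : ℝ) - 1) * ρ n) ^ (k - 1)))) /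
        ((((n : ℝ) - 1) * ρ n) ^ k) ^ 2) atTop (𝓝 0) := by
    have hreal : Tendsto (fun x : ℝ => C * (x ^ k * (k * ((k + 1) * (k + 1 + x) ^ (k - 1)))) /
        (x ^ k) ^ 2) atTop (𝓝 0) := by
      -- After cancellation one factor `x⁻¹` remains, multiplied by a bounded quantity: the
      -- fluctuation term is of order `1 / λ`.
      have hinv : Tendsto (fun x : ℝ => C * k * (k + 1) * ((k + 1) * x⁻¹ + 1) ^ (k - 1) * x⁻¹) atTop
          (𝓝 (C * k * (k + 1) * ((k + 1) * 0 + 1) ^ (k - 1) * 0)) :=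
        ((((tendsto_inv_atTop_zero.const_mul _).add_const 1).pow _).const_mul _).mul
          tendsto_inv_atTop_zero
      rw [mul_zero] at hinv
      refine hinv.congr' ?_
      filter_upwards [eventually_gt_atTop 0] with x hx
      obtain ⟨l, rfl⟩ := Nat.exists_eq_succ_of_ne_zero hk
      have h3 : ((l.succ : ℕ) + 1 : ℝ) * x⁻¹ + 1 = (l.succ + 1 + x) / x := by field_simp
      rw [h3, div_pow, Nat.succ_eq_add_one, Nat.add_sub_cancel]
      field_simp
      ring
    exact hreal.comp hdeg
  have h3 : Tendsto (fun n : ℕ => (((n - 1).descFactorial k : ℝ) / ((n : ℝ) - 1) ^ k - 1) ^ 2)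
      atTop (𝓝 0) := by
    have h4 : Tendsto (fun n : ℕ => ((n.descFactorial k : ℝ) / (n : ℝ) ^ k)) atTop (𝓝 1) := by
      refine (Asymptotics.isEquivalent_iff_tendsto_one ?_).1 (isEquivalent_descFactorial k)
      filter_upwards [eventually_gt_atTop 0] with n hn
      positivity
    have h5 := ((h4.comp (tendsto_sub_atTop_nat 1)).sub_const 1).pow 2
    simp only [sub_self, ne_eq, OfNat.ofNat_ne_zero, not_false_eq_true, zero_pow] at h5
    refine h5.congr' ?_
    filter_upwards [eventually_ge_atTop 1] with n hn
    simp [Nat.cast_sub hn]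
  have h1' := (ENNReal.continuous_ofReal.tendsto 0).comp h1
  have h3' := ENNReal.Tendsto.mul_const ((ENNReal.continuous_ofReal.tendsto 0).comp h3)
    (Or.inr hfin)
  rw [ENNReal.ofReal_zero] at h1' h3'
  rw [zero_mul] at h3'
  have h6 := ENNReal.Tendsto.const_mul (a := 3) ((h1'.add h2).add h3') (Or.inr (by simp))
  simp only [add_zero, mul_zero] at h6
  unfold pathDegreeError
  exact h6

end MeanSquare

/-! ### Averages over the vertices and the average degree -/

section Average

lemma lintegral_average_le {Ω : Type*} [MeasurableSpace Ω] {μ : Measure Ω} {n : ℕ}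
    {f : Fin n → Ω → ℝ} (hf : ∀ i, Measurable (f i)) (hf0 : ∀ i ω, 0 ≤ f i ω)
    {b : ℝ≥0∞} (hb : ∀ i, ∫⁻ ω, ENNReal.ofReal (f i ω) ∂μ ≤ b) :
    ∫⁻ ω, ENNReal.ofReal ((∑ i, f i ω) / n) ∂μ ≤ b := by
  rcases Nat.eq_zero_or_pos n with rfl | hn
  · simp
  have hn' : (0 : ℝ) < n := by exact_mod_cast hn
  have h1 : ∀ ω, ENNReal.ofReal ((∑ i, f i ω) / n)
      = (∑ i, ENNReal.ofReal (f i ω)) * (n : ℝ≥0∞)⁻¹ := fun ω => by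
    rw [ENNReal.ofReal_div_of_pos hn', ENNReal.ofReal_sum_of_nonneg fun i _ => hf0 i ω,
      ENNReal.ofReal_natCast, div_eq_mul_inv]
  simp_rw [h1]
  rw [lintegral_mul_const' _ _ (by simp [hn.ne']),
    lintegral_finsetSum _ fun i _ => (hf i).ennreal_ofReal]
  calc _ ≤ (∑ _i : Fin n, b) * (n : ℝ≥0∞)⁻¹ := by
        gcongr with i
        exact hb i
    _ = b := by
        rw [Finset.sum_const, Finset.card_univ, Fintype.card_fin, nsmul_eq_mul,
          mul_comm (n : ℝ≥0∞), mul_assoc, ENNReal.mul_inv_cancel (by simp [hn.ne']) (by simp),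
          mul_one]

lemma sq_average_le {n : ℕ} (f : Fin n → ℝ) : ((∑ i, f i) / n) ^ 2 ≤ (∑ i, f i ^ 2) / n := by
  rcases Nat.eq_zero_or_pos n with rfl | hn
  · simp
  have hn' : (0 : ℝ) < n := by exact_mod_cast hn
  have h := sq_sum_le_card_mul_sum_sq (s := Finset.univ) (f := f)
  rw [Finset.card_univ, Fintype.card_fin] at h
  rw [div_pow, div_le_div_iff₀ (by positivity) hn']
  calc (∑ i, f i) ^ 2 * n ≤ (n * ∑ i, f i ^ 2) * n := by gcongr
    _ = _ := by ring

lemma pathDegree_one {n : ℕ} (H : SimpleGraph (Fin n)) (i : Fin n) :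
    pathDegree H 1 i = (open Classical in H.degree i) := by
  classical
  rw [pathDegree, ← SimpleGraph.card_neighborFinset_eq_degree]
  refine Finset.card_bij' (fun p _ => p 1) (fun v _ => ![i, v]) ?_ ?_ ?_ ?_
  · intro p hp
    obtain ⟨-, h0, h1⟩ := (Finset.mem_filter.1 hp).2
    rw [SimpleGraph.mem_neighborFinset, ← h0]
    exact h1 0
  · intro v hv
    rw [SimpleGraph.mem_neighborFinset] at hv
    rw [Finset.mem_filter]
    refine ⟨Finset.mem_univ _, ?_, rfl, ?_⟩
    · intro a b
      fin_cases a <;> fin_cases b <;> simp [hv.ne, hv.ne']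
    · intro j
      fin_cases j
      exact hv
  · intro p hp
    obtain ⟨-, h0, -⟩ := (Finset.mem_filter.1 hp).2
    ext j
    fin_cases j
    · simp [h0]
    · rfl
  · intro v _
    rfl

lemma avgDegree_eq {n : ℕ} (H : SimpleGraph (Fin n)) :
    avgDegree H = (∑ i, (pathDegree H 1 i : ℝ)) / n := by
  simp only [avgDegree, pathDegree_one]

end Average

/-! ### Consequences of the moment and normalization hypotheses -/

section Kernel

variable {w : I → I → ℝ}

lemma momentBound_ne_top (hw : Measurable (Function.uncurry w)) (hw0 : ∀ u v, 0 ≤ w u v) {m : ℕ}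
    (hmom : Integrable fun p : I × I => w p.1 p.2 ^ (2 * m)) :
    momentBound volume (fun u v => ENNReal.ofReal (w u v)) m ≠ ∞ := by
  have h1 : ∫⁻ u : I, ∫⁻ v : I, ENNReal.ofReal (w u v) ^ (2 * m)
      = ∫⁻ p : I × I, ENNReal.ofReal (w p.1 p.2 ^ (2 * m)) := by
    have hm : Measurable fun p : I × I => ENNReal.ofReal (w p.1 p.2 ^ (2 * m)) :=
      (hw.pow_const _).ennreal_ofReal
    rw [Measure.volume_eq_prod, lintegral_prod _ hm.aemeasurable]
    simp_rw [ENNReal.ofReal_pow (hw0 _ _)]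
  rw [momentBound, h1]
  refine ENNReal.mul_ne_top (by finiteness) (ENNReal.add_ne_top.2 ⟨by simp, ?_⟩)
  exact hmom.lintegral_lt_top.ne

lemma pathMean_one (hw : Measurable (Function.uncurry w)) (hw0 : ∀ u v, 0 ≤ w u v) (u : I) :
    pathMean w 1 u = ∫ v, w u v := by
  have hm : Measurable fun v => w u v := measurable_kernel_comp hw measurable_const measurable_id
  rw [integral_eq_lintegral_of_nonneg_ae (ae_of_all _ fun v => hw0 u v) hm.aestronglyMeasurable]
  simp [pathMean, lpath, lkernelOp]

lemma integral_pathMean_one (hw : Measurable (Function.uncurry w)) (hw0 : ∀ u v, 0 ≤ w u v)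
    (hw1 : ∫ p : I × I, w p.1 p.2 = 1) : ∫ u, pathMean w 1 u = 1 := by
  -- Integrability follows from the normalization: a non-integrable function would have Bochner
  -- integral `0`, not `1`.
  have hi : Integrable (fun p : I × I => w p.1 p.2) (volume.prod volume) := by
    by_contra hcon
    rw [Measure.volume_eq_prod, integral_undef hcon] at hw1
    exact zero_ne_one hw1
  simp_rw [pathMean_one hw hw0]
  rw [← hw1, Measure.volume_eq_prod, integral_prod _ hi]

lemma theta_apply (hw : Measurable (Function.uncurry w)) (hw0 : ∀ u v, 0 ≤ w u v)
    (hsymm : ∀ u v, w u v = w v u) {m : ℕ}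
    (hfin : momentBound volume (fun u v => ENNReal.ofReal (w u v)) m ≠ ∞) (u : I) (k : Fin m) :
    theta m w u k = pathMean w (k + 1) u :=
  iterate_kernelOp_eq_toReal hw hw0 k (fun j hj =>
    ae_lpath_ne_top hw.ennreal_ofReal (fun u v => by rw [hsymm])
      (hj.trans k.isLt.le) hfin) u

end Kernel

/-! ### Normalization by the average degree -/

section Convergence

variable {m : ℕ} {w : I → I → ℝ} {ρ : ℕ → ℝ} {Ω : ℕ → Type*} [∀ n, MeasurableSpace (Ω n)]
  {μ : ∀ n, Measure (Ω n)} {ξ : ∀ n, Fin n → Ω n → I} {G : ∀ n, Ω n → SimpleGraph (Fin n)}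

lemma measurable_average_pathDegree (hw : Measurable (Function.uncurry w))
    (hG : ∀ n, IsLatentGraph (μ n) (edgeProb w (ρ n)) (ξ n) (G n)) (k n : ℕ) :
    Measurable fun ω => (∑ i, ((pathDegree (G n ω) k i : ℝ) /
      (((n : ℝ) - 1) * ρ n) ^ k - pathMean w k (ξ n i ω)) ^ 2) / (n : ℝ) :=
  (Finset.measurable_sum _ fun i _ => ((((hG n).measurable_pathDegree k i).div_const _).sub
    ((measurable_pathMean hw k).comp ((hG n).measurable_latent i))).pow_const 2).div_const _

variable [∀ n, IsProbabilityMeasure (μ n)]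

lemma tendsto_lintegral_average_pathDegree (hw : Measurable (Function.uncurry w))
    (hw0 : ∀ u v, 0 ≤ w u v) (hsymm : ∀ u v, w u v = w v u)
    (hfin : momentBound volume (fun u v => ENNReal.ofReal (w u v)) m ≠ ∞)
    (hρ : ∀ n, 0 < ρ n) (htrunc : Tendsto
      (fun n => eLpNorm (fun p : I × I => truncKernel w (ρ n) p.1 p.2 - w p.1 p.2) 2 volume)
      atTop (𝓝 0))
    (hdeg : Tendsto (fun n : ℕ => ((n : ℝ) - 1) * ρ n) atTop atTop)
    (hG : ∀ n, IsLatentGraph (μ n) (edgeProb w (ρ n)) (ξ n) (G n))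
    {k : ℕ} (hk : k ≠ 0) (hkm : k ≤ m) :
    Tendsto (fun n => ∫⁻ ω, ENNReal.ofReal ((∑ i, ((pathDegree (G n ω) k i : ℝ) /
      ((n - 1) * ρ n) ^ k - pathMean w k (ξ n i ω)) ^ 2) / n) ∂μ n) atTop (𝓝 0) := by
  refine tendsto_of_tendsto_of_tendsto_of_le_of_le' tendsto_const_nhds
    (tendsto_pathDegreeError hw hw0 hsymm hk hkm hfin htrunc hdeg)
    (Eventually.of_forall fun _ => zero_le) ?_
  filter_upwards [eventually_ge_atTop 2] with n hn
  refine lintegral_average_le (fun i => ?_) (fun i ω => sq_nonneg _) fun i =>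
    (hG n).lintegral_pathDegree_sub_sq_le (hρ n) hw hw0 hsymm hk hkm hfin hn i
  exact ((((hG n).measurable_pathDegree k i).div_const _).sub
    ((measurable_pathMean hw k).comp ((hG n).measurable_latent i))).pow_const 2

/-- The average degree is asymptotic to `(n - 1) ρ`. -/
lemma vanish_avgDegree_sub (hm : 1 ≤ m) (hw : Measurable (Function.uncurry w))
    (hw0 : ∀ u v, 0 ≤ w u v) (hsymm : ∀ u v, w u v = w v u) (hw1 : ∫ p : I × I, w p.1 p.2 = 1)
    (hfin : momentBound volume (fun u v => ENNReal.ofReal (w u v)) m ≠ ∞)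
    (hρ : ∀ n, 0 < ρ n) (htrunc : Tendsto
      (fun n => eLpNorm (fun p : I × I => truncKernel w (ρ n) p.1 p.2 - w p.1 p.2) 2 volume)
      atTop (𝓝 0))
    (hdeg : Tendsto (fun n : ℕ => ((n : ℝ) - 1) * ρ n) atTop atTop)
    (hG : ∀ n, IsLatentGraph (μ n) (edgeProb w (ρ n)) (ξ n) (G n)) :
    Vanish μ fun n ω => (avgDegree (G n ω) / ((n - 1) * ρ n) - 1) ^ 2 := by
  have h1 := Vanish.of_lintegral (fun n => measurable_average_pathDegree hw hG 1 n)
    (tendsto_lintegral_average_pathDegree hw hw0 hsymm hfin hρ htrunc hdeg hG one_ne_zero hm)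
  have h2 := vanish_average_sub_integral hG (measurable_pathMean hw 1)
    (memLp_pathMean hw hsymm one_ne_zero hm hfin)
  rw [integral_pathMean_one hw hw0 hw1] at h2
  refine ((h1.add h2).const_mul two_pos).mono (Eventually.of_forall fun n ω => ?_)
  have h3 := sq_average_le fun i => (pathDegree (G n ω) 1 i : ℝ) /
      ((n - 1) * ρ n) ^ 1 - pathMean w 1 (ξ n i ω)
  set A := (∑ i, ((pathDegree (G n ω) 1 i : ℝ) /
      ((n - 1) * ρ n) ^ 1 - pathMean w 1 (ξ n i ω))) / (n : ℝ) with hA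
  set B := (∑ i, pathMean w 1 (ξ n i ω)) / (n : ℝ) with hB
  -- `A` is the averaged error of the degrees, controlled by the mean square error; `B - 1` is the
  -- deviation in the law of large numbers, as `pathMean w 1` has integral `1`.
  have h4 : avgDegree (G n ω) / ((n - 1) * ρ n) - 1 = A + (B - 1) := by
    rw [hA, hB, avgDegree_eq, Finset.sum_sub_distrib, ← Finset.sum_div]
    ring
  rw [h4]
  nlinarith [sq_nonneg (A - (B - 1))]

/-- Changing the normalization multiplies `a = D_i^(k) / λ ^ k` by `s`, the `k`-th power of `λ /
D̄`, which tends to `1` and does not depend on `i`. The extra errors are `(s - 1) ^ 2` times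
averages that are bounded in mean, so they vanish without any moment bound on `s`. -/
lemma vanish_average_normalized (hm : 1 ≤ m) (hw : Measurable (Function.uncurry w))
    (hw0 : ∀ u v, 0 ≤ w u v) (hsymm : ∀ u v, w u v = w v u) (hw1 : ∫ p : I × I, w p.1 p.2 = 1)
    (hfin : momentBound volume (fun u v => ENNReal.ofReal (w u v)) m ≠ ∞)
    (hρ : ∀ n, 0 < ρ n) (htrunc : Tendsto
      (fun n => eLpNorm (fun p : I × I => truncKernel w (ρ n) p.1 p.2 - w p.1 p.2) 2 volume)
      atTop (𝓝 0))
    (hdeg : Tendsto (fun n : ℕ => ((n : ℝ) - 1) * ρ n) atTop atTop)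
    (hG : ∀ n, IsLatentGraph (μ n) (edgeProb w (ρ n)) (ξ n) (G n))
    {k : ℕ} (hk : k ≠ 0) (hkm : k ≤ m) :
    Vanish μ fun n ω => (∑ i, ((pathDegree (G n ω) k i : ℝ) / avgDegree (G n ω) ^ k
      - pathMean w k (ξ n i ω)) ^ 2) / n := by
  set R : ∀ n, Ω n → ℝ := fun n ω => (∑ i, ((pathDegree (G n ω) k i : ℝ) /
      ((n - 1) * ρ n) ^ k - pathMean w k (ξ n i ω)) ^ 2) / n with hR
  set Q : ∀ n, Ω n → ℝ := fun n ω => (∑ i, pathMean w k (ξ n i ω) ^ 2) / n with hQ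
  set s : ∀ n, Ω n → ℝ := fun n ω => ((avgDegree (G n ω) / ((n - 1) * ρ n))⁻¹) ^ k with hs
  have hRm : ∀ n, Measurable (R n) := fun n => measurable_average_pathDegree hw hG k n
  have hR0 : ∀ n ω, 0 ≤ R n ω := fun n ω =>
    div_nonneg (Finset.sum_nonneg fun i _ => sq_nonneg _) (Nat.cast_nonneg n)
  have hQ0 : ∀ n ω, 0 ≤ Q n ω := fun n ω =>
    div_nonneg (Finset.sum_nonneg fun i _ => sq_nonneg _) (Nat.cast_nonneg n)
  have hφm : ∀ n i, Measurable fun ω => pathMean w k (ξ n i ω) ^ 2 := fun n i =>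
    ((measurable_pathMean hw k).comp ((hG n).measurable_latent i)).pow_const 2
  have hQm : ∀ n, Measurable (Q n) := fun n =>
    (Finset.measurable_sum _ fun i _ => hφm n i).div_const _
  have hRlim := tendsto_lintegral_average_pathDegree hw hw0 hsymm hfin hρ htrunc hdeg hG hk hkm
  have hRv : Vanish μ R := Vanish.of_lintegral hRm hRlim
  have hQle : ∀ n, ∫⁻ ω, ENNReal.ofReal (Q n ω) ∂μ n ≤
      momentBound volume (fun u v => ENNReal.ofReal (w u v)) m := fun n =>
    lintegral_average_le (hφm n) (fun i ω => sq_nonneg _) fun i => by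
      rw [(hG n).lintegral_latent (f := fun u => ENNReal.ofReal (pathMean w k u ^ 2))
        ((measurable_pathMean hw k).pow_const 2).ennreal_ofReal i]
      exact lintegral_pathMean_sq_le hw hsymm hk hkm
  have hsv : Vanish μ fun n ω => (s n ω - 1) ^ 2 := by
    have h := (vanish_avgDegree_sub hm hw hw0 hsymm hw1 hfin hρ htrunc hdeg
      hG).sq_sub_of_continuousAt (f := fun x => (x⁻¹) ^ k)
      ((continuousAt_inv₀ one_ne_zero).pow k)
    simpa only [inv_one, one_pow] using h
  have hsR := hsv.mul_of_lintegral_le hRm hR0 ENNReal.one_ne_top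
    (hRlim.eventually (ge_mem_nhds zero_lt_one))
  have hsQ := hsv.mul_of_lintegral_le hQm hQ0 hfin (Eventually.of_forall hQle)
  refine (((hRv.add hsR).add hsQ).const_mul three_pos).mono ?_
  filter_upwards [hdeg.eventually_gt_atTop 0] with n hn ω
  have hterm : ∀ i, ((pathDegree (G n ω) k i : ℝ) / avgDegree (G n ω) ^ k
      - pathMean w k (ξ n i ω)) ^ 2 ≤ 3 * (((pathDegree (G n ω) k i : ℝ) /
      ((n - 1) * ρ n) ^ k - pathMean w k (ξ n i ω)) ^ 2 + (s n ω - 1) ^ 2 *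
      ((pathDegree (G n ω) k i : ℝ) / ((n - 1) * ρ n) ^ k - pathMean w k (ξ n i ω)) ^ 2 +
      (s n ω - 1) ^ 2 * pathMean w k (ξ n i ω) ^ 2) := by
    intro i
    set φ := pathMean w k (ξ n i ω)
    set a := (pathDegree (G n ω) k i : ℝ) / ((n - 1) * ρ n) ^ k with ha
    -- This also covers `D̄ = 0`: both sides are then `0`, as `k ≠ 0` and division by zero gives
    -- zero. Only `λ ^ k ≠ 0` is needed for the cancellation.
    have h1 : (pathDegree (G n ω) k i : ℝ) / avgDegree (G n ω) ^ k = s n ω * a := by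
      simp only [hs, ha]
      rw [inv_div, div_pow, div_mul_div_comm, mul_comm, mul_div_mul_right _ _ (pow_pos hn k).ne']
    rw [h1, show s n ω * a - φ = (a - φ) + (s n ω - 1) * (a - φ) + (s n ω - 1) * φ by ring,
      ← mul_pow, ← mul_pow]
    nlinarith [sq_nonneg ((a - φ) - (s n ω - 1) * (a - φ)),
      sq_nonneg ((a - φ) - (s n ω - 1) * φ),
      sq_nonneg ((s n ω - 1) * (a - φ) - (s n ω - 1) * φ)]
  calc _ ≤ (∑ i, 3 * (((pathDegree (G n ω) k i : ℝ) /
      ((n - 1) * ρ n) ^ k - pathMean w k (ξ n i ω)) ^ 2 + (s n ω - 1) ^ 2 *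
      ((pathDegree (G n ω) k i : ℝ) / ((n - 1) * ρ n) ^ k - pathMean w k (ξ n i ω)) ^ 2 +
      (s n ω - 1) ^ 2 * pathMean w k (ξ n i ω) ^ 2)) / (n : ℝ) :=
        div_le_div_of_nonneg_right (Finset.sum_le_sum fun i _ => hterm i) (Nat.cast_nonneg n)
    _ = _ := by
        rw [← Finset.mul_sum, Finset.sum_add_distrib, Finset.sum_add_distrib, ← Finset.mul_sum,
          ← Finset.mul_sum]
        simp only [hR, hQ]
        ring

/-- The mean square distance between the normalized degree vectors and `θ_m(ξ i)` vanishes. -/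
theorem vanish_average_degreeVec_sub_theta (hm : 1 ≤ m) (hw : Measurable (Function.uncurry w))
    (hw0 : ∀ u v, 0 ≤ w u v) (hsymm : ∀ u v, w u v = w v u) (hw1 : ∫ p : I × I, w p.1 p.2 = 1)
    (hfin : momentBound volume (fun u v => ENNReal.ofReal (w u v)) m ≠ ∞)
    (hρ : ∀ n, 0 < ρ n) (htrunc : Tendsto
      (fun n => eLpNorm (fun p : I × I => truncKernel w (ρ n) p.1 p.2 - w p.1 p.2) 2 volume)
      atTop (𝓝 0))
    (hdeg : Tendsto (fun n : ℕ => ((n : ℝ) - 1) * ρ n) atTop atTop)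
    (hG : ∀ n, IsLatentGraph (μ n) (edgeProb w (ρ n)) (ξ n) (G n)) :
    Vanish μ fun n ω => (∑ i, ‖degreeVec m (G n ω) i - theta m w (ξ n i ω)‖ ^ 2) / n := by
  have h := Vanish.sum (μ := μ) (Finset.univ : Finset (Fin m))
    (Z := fun k n ω => (∑ i, ((pathDegree (G n ω) (k + 1) i : ℝ) /
      avgDegree (G n ω) ^ ((k : ℕ) + 1) - pathMean w (k + 1) (ξ n i ω)) ^ 2) / n)
    fun k _ => vanish_average_normalized hm hw hw0 hsymm hw1 hfin hρ htrunc hdeg hG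
      (Nat.succ_ne_zero k) k.isLt
  refine h.mono (Eventually.of_forall fun n ω => le_of_eq ?_)
  rw [← Finset.sum_div, Finset.sum_comm]
  congr 1
  refine Finset.sum_congr rfl fun i _ => ?_
  rw [EuclideanSpace.real_norm_sq_eq]
  refine Finset.sum_congr rfl fun k _ => ?_
  rw [PiLp.sub_apply, theta_apply hw hw0 hsymm hfin]
  rfl

end Convergence

lemma integral_empirical {E : Type*} [MeasurableSpace E] {n : ℕ} (x : Fin n → E) {f : E → ℝ}
    (hf : Measurable f) : ∫ z, f z ∂(empirical x) = (∑ i, f (x i)) / n := by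
  rw [empirical, integral_smul_measure, integral_finsetSum_measure]
  · simp [integral_dirac' _ _ hf.stronglyMeasurable, div_eq_inv_mul]
  · intro i _
    exact integrable_dirac' hf.stronglyMeasurable (by simp)

/-! ### Mallows distance of an empirical distribution to the law of `θ` -/

section Mallows

lemma mallows_le_of_coupling {F : Type*} [MeasurableSpace F] [NormedAddCommGroup F]
    {P Q : Measure F} {γ : Measure (F × F)} (h1 : γ.map Prod.fst = P) (h2 : γ.map Prod.snd = Q) :
    mallows P Q ≤ (∫⁻ z, ‖z.1 - z.2‖ₑ ^ 2 ∂γ) ^ (1 / 2 : ℝ) :=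
  (iInf_le _ γ).trans ((iInf_le _ h1).trans (iInf_le _ h2))

lemma isProbabilityMeasure_empirical {F : Type*} [MeasurableSpace F] {n : ℕ} (hn : 0 < n)
    (x : Fin n → F) : IsProbabilityMeasure (empirical x) := by
  refine ⟨?_⟩
  simp only [empirical, Measure.smul_apply, Measure.coe_finsetSum, Finset.sum_apply, measure_univ,
    Finset.sum_const, Finset.card_univ, Fintype.card_fin, smul_eq_mul, nsmul_eq_mul, mul_one]
  exact ENNReal.inv_mul_cancel (by simp [hn.ne']) (by simp)

lemma map_empirical {F F' : Type*} [MeasurableSpace F] [MeasurableSpace F'] {n : ℕ}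
    (x : Fin n → F) {f : F → F'} (hf : Measurable f) :
    (empirical x).map f = empirical fun i => f (x i) := by
  ext s hs
  simp only [empirical, Measure.map_apply hf hs, Measure.smul_apply, Measure.coe_finsetSum,
    Finset.sum_apply, Measure.dirac_apply' _ hs, Measure.dirac_apply' _ (hf hs)]
  rfl

lemma lintegral_empirical_ofReal {F : Type*} [MeasurableSpace F] {n : ℕ} (hn : 0 < n)
    (x : Fin n → F) {f : F → ℝ} (hf : Measurable f) (hf0 : ∀ z, 0 ≤ f z) :
    ∫⁻ z, ENNReal.ofReal (f z) ∂(empirical x) = ENNReal.ofReal ((∑ i, f (x i)) / n) := by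
  have hn' : (0 : ℝ) < n := by exact_mod_cast hn
  rw [empirical, lintegral_smul_measure, lintegral_finsetSum_measure, ENNReal.ofReal_div_of_pos hn',
    ENNReal.ofReal_sum_of_nonneg fun i _ => hf0 _, ENNReal.ofReal_natCast, div_eq_mul_inv,
    mul_comm, smul_eq_mul]
  simp only [lintegral_dirac' _ hf.ennreal_ofReal]

variable {E : Type*} [NormedAddCommGroup E]

lemma enorm_sq_eq_ofReal (x : E) : ‖x‖ₑ ^ 2 = ENNReal.ofReal (‖x‖ ^ 2) := by
  rw [← ofReal_norm, ENNReal.ofReal_pow (norm_nonneg _)]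

lemma norm_sub_sq_le_four (a b c d e : E) :
    ‖a - e‖ ^ 2 ≤ 4 * (‖a - b‖ ^ 2 + ‖b - c‖ ^ 2 + ‖c - d‖ ^ 2 + ‖e - d‖ ^ 2) := by
  have h : ‖a - e‖ ≤ ‖a - b‖ + ‖b - c‖ + ‖c - d‖ + ‖e - d‖ := by
    rw [norm_sub_rev e d]
    calc ‖a - e‖ ≤ ‖a - d‖ + ‖d - e‖ := norm_sub_le_norm_sub_add_norm_sub _ _ _
      _ ≤ (‖a - c‖ + ‖c - d‖) + ‖d - e‖ := by
          gcongr; exact norm_sub_le_norm_sub_add_norm_sub _ _ _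
      _ ≤ _ := by
          gcongr; exact norm_sub_le_norm_sub_add_norm_sub _ _ _
  refine (pow_le_pow_left₀ (norm_nonneg _) h 2).trans ?_
  have := sq_sum_le_card_mul_sum_sq (s := Finset.univ) (f := ![‖a - b‖, ‖b - c‖, ‖c - d‖, ‖e - d‖])
  simpa [Fin.sum_univ_four] using this

lemma exists_simpleFunc_lintegral_le {θ : I → E} (hθ : MemLp θ 2 (volume : Measure I)) {η : ℝ}
    (hη : 0 < η) :
    ∃ s : SimpleFunc I E, ∫⁻ u, ENNReal.ofReal (‖θ u - s u‖ ^ 2) ≤ ENNReal.ofReal η := by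
  obtain ⟨s, hs, -⟩ := hθ.exists_simpleFunc_eLpNorm_sub_lt (by simp)
    (ε := ENNReal.ofReal (Real.sqrt η)) (by simpa using hη)
  refine ⟨s, ?_⟩
  have h1 := eLpNorm_nnreal_pow_eq_lintegral (f := θ - ⇑s) (μ := (volume : Measure I)) (p := 2)
    (by norm_num)
  have h2 : ∫⁻ u, ENNReal.ofReal (‖θ u - s u‖ ^ 2) = eLpNorm (θ - ⇑s) 2 volume ^ 2 := by
    simp only [← enorm_sq_eq_ofReal]
    have h3 : eLpNorm (θ - ⇑s) 2 (volume : Measure I) ^ (2 : ℝ)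
        = ∫⁻ u, ‖(θ - ⇑s) u‖ₑ ^ (2 : ℝ) := by simpa using h1
    simpa using h3.symm
  rw [h2, ← Real.sq_sqrt hη.le, ENNReal.ofReal_pow (Real.sqrt_nonneg _)]
  exact pow_le_pow_left' hs.le 2

variable [MeasurableSpace E] [BorelSpace E] [SecondCountableTopology E]

/-- The Mallows distance between an empirical distribution and the law of `θ`, bounded by means of
a simple approximation `s` of `θ` and sample points `y`. -/
lemma mallows_empirical_le {n : ℕ} (hn : 0 < n) (x : Fin n → E) (y : Fin n → I) {θ : I → E}
    (hθ : Measurable θ) (s : SimpleFunc I E) {B η : ℝ} (hB : ∀ u v, ‖s u - s v‖ ^ 2 ≤ B)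
    (hη : 0 ≤ η) (hs : ∫⁻ u, ENNReal.ofReal (‖θ u - s u‖ ^ 2) ≤ ENNReal.ofReal η) :
    mallows (empirical x) (Measure.map θ volume) ≤ ENNReal.ofReal
      (4 * ((∑ i, ‖x i - θ (y i)‖ ^ 2) / n + (∑ i, ‖θ (y i) - s (y i)‖ ^ 2) / n +
        B * ∑ k : s.range, |(∑ i, (s ⁻¹' {k.1}).indicator (fun _ => (1 : ℝ)) (y i)) / n -
          ∫ u, (s ⁻¹' {k.1}).indicator (fun _ => (1 : ℝ)) u| + η)) ^ (1 / 2 : ℝ) := by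
  have hB0 : 0 ≤ B := (sq_nonneg _).trans (hB 0 0)
  have hP := isProbabilityMeasure_empirical hn (id : Fin n → Fin n)
  -- The label of an index is the value of `s` at its sample point. Coupling indices, rather than
  -- the points `x i` themselves, keeps `y i` available when `x` is not injective.
  set f : Fin n → s.range := fun i => ⟨s (y i), s.mem_range_self _⟩ with hf
  set g : I → s.range := fun u => ⟨s u, s.mem_range_self _⟩ with hg
  have hfm : Measurable f := measurable_of_finite f
  have hgm : Measurable g := s.measurable.subtype_mk
  obtain ⟨γ, h1, h2, h3⟩ := exists_coupling_labels (empirical (id : Fin n → Fin n)) volume hfm hgm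
  have hxm : Measurable x := measurable_of_finite x
  have hφ : Measurable fun z : Fin n × I => (x z.1, θ z.2) :=
    (hxm.comp measurable_fst).prodMk (hθ.comp measurable_snd)
  have hlab : ∀ k : s.range, empirical (id : Fin n → Fin n) (f ⁻¹' {k}) - volume (g ⁻¹' {k}) ≤
      ENNReal.ofReal |(∑ i, (s ⁻¹' {k.1}).indicator (fun _ => (1 : ℝ)) (y i)) / n -
          ∫ u, (s ⁻¹' {k.1}).indicator (fun _ => (1 : ℝ)) u| := by
    intro k
    have hm : MeasurableSet (s ⁻¹' {k.1}) := s.measurableSet_preimage _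
    have e1 : f ⁻¹' {k} = {i | y i ∈ s ⁻¹' {k.1}} := by
      ext i; simp [hf, Subtype.ext_iff]
    have e2 : g ⁻¹' {k} = s ⁻¹' {k.1} := by
      ext i; simp [hg, Subtype.ext_iff]
    have e3 : empirical (id : Fin n → Fin n) (f ⁻¹' {k}) = ENNReal.ofReal
        ((∑ i, (s ⁻¹' {k.1}).indicator (fun _ => (1 : ℝ)) (y i)) / n) := by
      have e5 := lintegral_empirical_ofReal hn (id : Fin n → Fin n)
        (f := fun i => (s ⁻¹' {k.1}).indicator (fun _ => (1 : ℝ)) (y i)) (measurable_of_finite _)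
        (fun i => Set.indicator_nonneg (fun _ _ => zero_le_one) _)
      simp only [id] at e5
      rw [← e5, ← lintegral_indicator_one (Set.toFinite _).measurableSet, e1]
      refine lintegral_congr fun i => ?_
      by_cases hi : y i ∈ s ⁻¹' {k.1}
      · rw [Set.indicator_of_mem hi, Set.indicator_of_mem (by exact hi)]; simp
      · rw [Set.indicator_of_notMem hi, Set.indicator_of_notMem (by exact hi)]; simp
    have e4 : (volume : Measure I) (g ⁻¹' {k}) = ENNReal.ofReal
        (∫ u, (s ⁻¹' {k.1}).indicator (fun _ => (1 : ℝ)) u) := by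
      rw [integral_indicator hm, setIntegral_const, smul_eq_mul, mul_one, e2, measureReal_def,
        ENNReal.ofReal_toReal (measure_ne_top _ _)]
    rw [e3, e4, ← ENNReal.ofReal_sub _
      (integral_nonneg fun u => Set.indicator_nonneg (fun _ _ => zero_le_one) _)]
    exact ENNReal.ofReal_le_ofReal (le_abs_self _)
  have hfst : (γ.map fun z => (x z.1, θ z.2)).map Prod.fst = empirical x := by
    rw [Measure.map_map measurable_fst hφ]
    change γ.map (x ∘ Prod.fst) = _
    rw [← Measure.map_map hxm measurable_fst, h1, map_empirical _ hxm]
    rfl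
  have hsnd : (γ.map fun z => (x z.1, θ z.2)).map Prod.snd = Measure.map θ volume := by
    rw [Measure.map_map measurable_snd hφ]
    change γ.map (θ ∘ Prod.snd) = _
    rw [← Measure.map_map hθ measurable_snd, h2]
  refine (mallows_le_of_coupling hfst hsnd).trans ?_
  refine ENNReal.rpow_le_rpow ?_ (by norm_num)
  have hm1 : Measurable fun i => ENNReal.ofReal (‖x i - θ (y i)‖ ^ 2) := measurable_of_finite _
  have hm2 : Measurable fun i => ENNReal.ofReal (‖θ (y i) - s (y i)‖ ^ 2) := measurable_of_finite _
  have hm4 : Measurable fun u => ENNReal.ofReal (‖θ u - s u‖ ^ 2) :=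
    ((hθ.sub s.measurable).norm.pow_const 2).ennreal_ofReal
  have hd : Measurable fun z : E × E => ‖z.1 - z.2‖ₑ ^ 2 :=
    (measurable_fst.sub measurable_snd).enorm.pow_const 2
  rw [lintegral_map hd hφ]
  -- The chain runs from `x i` through `θ (y i)`, `s (y i)` and `s u` to `θ u`. Its third step is
  -- zero when the labels agree and costs at most `B` otherwise; the other three depend on only one
  -- of `i` and `u`, so their integrals need only the marginals.
  calc _ ≤ ∫⁻ z, 4 * (ENNReal.ofReal (‖x z.1 - θ (y z.1)‖ ^ 2) +
        ENNReal.ofReal (‖θ (y z.1) - s (y z.1)‖ ^ 2) +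
        {z : Fin n × I | f z.1 ≠ g z.2}.indicator (fun _ => ENNReal.ofReal B) z +
        ENNReal.ofReal (‖θ z.2 - s z.2‖ ^ 2)) ∂γ := by
        refine lintegral_mono fun z => ?_
        rw [enorm_sq_eq_ofReal]
        refine (ENNReal.ofReal_le_ofReal (norm_sub_sq_le_four (x z.1) (θ (y z.1)) (s (y z.1))
          (s z.2) (θ z.2))).trans ?_
        rw [ENNReal.ofReal_mul (by norm_num), ENNReal.ofReal_add (by positivity) (by positivity),
          ENNReal.ofReal_add (by positivity) (by positivity),
          ENNReal.ofReal_add (by positivity) (by positivity)]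
        have h5 : ENNReal.ofReal (‖s (y z.1) - s z.2‖ ^ 2) ≤
            {z : Fin n × I | f z.1 ≠ g z.2}.indicator (fun _ => ENNReal.ofReal B) z := by
          by_cases hz : f z.1 = g z.2
          · have : s (y z.1) = s z.2 := congrArg Subtype.val hz
            simp [this]
          · rw [Set.indicator_of_mem (by exact hz)]
            exact ENNReal.ofReal_le_ofReal (hB _ _)
        rw [show ENNReal.ofReal 4 = 4 by simp]
        gcongr
    _ = 4 * (∫⁻ i, ENNReal.ofReal (‖x i - θ (y i)‖ ^ 2) ∂(empirical (id : Fin n → Fin n)) +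
        ∫⁻ i, ENNReal.ofReal (‖θ (y i) - s (y i)‖ ^ 2) ∂(empirical (id : Fin n → Fin n)) +
        (∫⁻ z, {z : Fin n × I | f z.1 ≠ g z.2}.indicator (fun _ => ENNReal.ofReal B) z ∂γ) +
        ∫⁻ u, ENNReal.ofReal (‖θ u - s u‖ ^ 2)) := by
        have hm1' : Measurable fun z : Fin n × I => ENNReal.ofReal (‖x z.1 - θ (y z.1)‖ ^ 2) :=
          hm1.comp measurable_fst
        have hm2' : Measurable fun z : Fin n × I =>
          ENNReal.ofReal (‖θ (y z.1) - s (y z.1)‖ ^ 2) := hm2.comp measurable_fst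
        have hm4' : Measurable fun z : Fin n × I => ENNReal.ofReal (‖θ z.2 - s z.2‖ ^ 2) :=
          hm4.comp measurable_snd
        have hm12 : Measurable fun z : Fin n × I => ENNReal.ofReal (‖x z.1 - θ (y z.1)‖ ^ 2) +
            ENNReal.ofReal (‖θ (y z.1) - s (y z.1)‖ ^ 2) := hm1'.add hm2'
        rw [lintegral_const_mul' _ _ (by simp), lintegral_add_right _ hm4',
          lintegral_add_left hm12, lintegral_add_left hm1', ← h1,
          lintegral_map hm1 measurable_fst, lintegral_map hm2 measurable_fst]
        conv_rhs => rw [← h2, lintegral_map hm4 measurable_snd]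
    _ ≤ 4 * (ENNReal.ofReal ((∑ i, ‖x i - θ (y i)‖ ^ 2) / n) +
        ENNReal.ofReal ((∑ i, ‖θ (y i) - s (y i)‖ ^ 2) / n) +
        ENNReal.ofReal B * ∑ k : s.range, ENNReal.ofReal
          |(∑ i, (s ⁻¹' {k.1}).indicator (fun _ => (1 : ℝ)) (y i)) / n -
          ∫ u, (s ⁻¹' {k.1}).indicator (fun _ => (1 : ℝ)) u| + ENNReal.ofReal η) := by
        rw [lintegral_empirical_ofReal hn _ (measurable_of_finite _) fun i => sq_nonneg _,
          lintegral_empirical_ofReal hn _ (measurable_of_finite _) fun i => sq_nonneg _]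
        simp only [id]
        gcongr
        exact (lintegral_indicator_const_le _ _).trans
          (mul_le_mul_right (h3.trans (Finset.sum_le_sum fun k _ => hlab k)) _)
    _ = _ := by
        have hp1 : 0 ≤ (∑ i, ‖x i - θ (y i)‖ ^ 2) / (n : ℝ) := by positivity
        have hp2 : 0 ≤ (∑ i, ‖θ (y i) - s (y i)‖ ^ 2) / (n : ℝ) := by positivity
        have hp3 : 0 ≤ ∑ k : s.range,
            |(∑ i, (s ⁻¹' {k.1}).indicator (fun _ => (1 : ℝ)) (y i)) / n -
              ∫ u, (s ⁻¹' {k.1}).indicator (fun _ => (1 : ℝ)) u| :=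
          Finset.sum_nonneg fun k _ => abs_nonneg _
        rw [ENNReal.ofReal_mul (by norm_num), ENNReal.ofReal_add (by positivity) hη,
          ENNReal.ofReal_add (by positivity) (mul_nonneg hB0 hp3), ENNReal.ofReal_add hp1 hp2,
          ENNReal.ofReal_mul hB0, ENNReal.ofReal_sum_of_nonneg fun k _ => abs_nonneg _]
        simp

variable {Ω : ℕ → Type*} [∀ n, MeasurableSpace (Ω n)] {μ : ∀ n, Measure (Ω n)}
  [∀ n, IsProbabilityMeasure (μ n)] {h : ℕ → I → I → ℝ} {ξ : ∀ n, Fin n → Ω n → I}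
  {G : ∀ n, Ω n → SimpleGraph (Fin n)}

/-- Points that are close in mean square to the images `θ(ξ i)` have an empirical distribution
close to the law of `θ`. -/
theorem tendsto_mallows_empirical (hG : ∀ n, IsLatentGraph (μ n) (h n) (ξ n) (G n)) {θ : I → E}
    (hθm : Measurable θ) (hθ : MemLp θ 2 (volume : Measure I)) {x : ∀ n, Ω n → Fin n → E}
    (hx : Vanish μ fun n ω => (∑ i, ‖x n ω i - θ (ξ n i ω)‖ ^ 2) / n) (ε : ℝ≥0∞) (hε : 0 < ε) :
    Tendsto (fun n => μ n {ω | ε ≤ mallows (empirical (x n ω)) (Measure.map θ volume)})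
      atTop (𝓝 0) := by
  -- The minimum with `1` covers `ε = ∞`; `e` is a real threshold for the squared distance.
  obtain ⟨e, he0, he⟩ : ∃ e : ℝ, 0 < e ∧ ENNReal.ofReal e ≤ ε ^ 2 := by
    have hmt : min ε 1 ≠ ∞ := ne_top_of_le_ne_top ENNReal.one_ne_top (min_le_right _ _)
    have hpos : 0 < (min ε 1).toReal :=
      ENNReal.toReal_pos (lt_min hε zero_lt_one).ne' hmt
    refine ⟨(min ε 1).toReal ^ 2, pow_pos hpos 2, ?_⟩
    rw [ENNReal.ofReal_pow hpos.le, ENNReal.ofReal_toReal hmt]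
    exact pow_le_pow_left' (min_le_left _ _) 2
  rw [ENNReal.tendsto_nhds_zero]
  intro ζ hζ
  -- The budget is `4 * (e / 8 + e / 16 + e / 16) = e`, for the vanishing terms, the sampled
  -- approximation error and `η`. The last condition is for Markov's inequality: the sampled error
  -- need not vanish, but it exceeds `e / 16` with probability at most `ζ / 2`.
  obtain ⟨η, hη0, hηe, hηζ⟩ : ∃ η : ℝ, 0 < η ∧ η ≤ e / 16 ∧
      ENNReal.ofReal η / ENNReal.ofReal (e / 16) ≤ ζ / 2 := by
    have h0 : ENNReal.ofReal (e / 16) ≠ 0 := by simp [he0]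
    have h1 : Tendsto (fun η : ℝ => ENNReal.ofReal η / ENNReal.ofReal (e / 16)) (𝓝[>] 0) (𝓝 0) := by
      have h2 := ENNReal.Tendsto.div_const (b := ENNReal.ofReal (e / 16))
        (ENNReal.continuous_ofReal.tendsto 0) (Or.inr h0)
      rw [ENNReal.ofReal_zero, ENNReal.zero_div] at h2
      exact h2.mono_left nhdsWithin_le_nhds
    have h3 := (h1.eventually (ge_mem_nhds (ENNReal.half_pos hζ.ne'))).and
      (Ioc_mem_nhdsGT (show (0 : ℝ) < e / 16 by positivity))
    obtain ⟨η, h4, h5⟩ := h3.exists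
    exact ⟨η, h5.1, h5.2, h4⟩
  obtain ⟨s, hs⟩ := exists_simpleFunc_lintegral_le hθ hη0
  obtain ⟨C, hC⟩ := s.exists_forall_norm_le
  -- The summand `1` makes `B` strictly positive, as `Vanish.const_mul` requires.
  set B : ℝ := (2 * C) ^ 2 + 1 with hBdef
  have hB : ∀ u v, ‖s u - s v‖ ^ 2 ≤ B := fun u v => by
    have h1 : ‖s u - s v‖ ≤ 2 * C := (norm_sub_le _ _).trans (by linarith [hC u, hC v])
    have := pow_le_pow_left₀ (norm_nonneg _) h1 2
    linarith
  have hlab : Vanish μ fun n ω => ∑ k : s.range,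
      |(∑ i, (s ⁻¹' {k.1}).indicator (fun _ => (1 : ℝ)) (ξ n i ω)) / n -
          ∫ u, (s ⁻¹' {k.1}).indicator (fun _ => (1 : ℝ)) u| := by
    refine Vanish.sum _ fun k _ => ?_
    have hm : MeasurableSet (s ⁻¹' {k.1}) := s.measurableSet_preimage _
    have h1 := vanish_average_sub_integral hG
      (f := (s ⁻¹' {k.1}).indicator (fun _ => (1 : ℝ))) (measurable_const.indicator hm)
      ((memLp_const (1 : ℝ)).indicator hm)
    exact fun δ hδ => h1.of_subset (pow_pos hδ 2) (Eventually.of_forall fun n ω hω => by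
      simp only [Set.mem_ofPred_eq] at hω ⊢
      rw [← sq_abs (_ - _)]
      exact pow_le_pow_left₀ hδ.le hω 2)
  have hV := hx.add (hlab.const_mul (show 0 < B by positivity))
  set W : ∀ n, Ω n → ℝ := fun n ω => (∑ i, ‖θ (ξ n i ω) - s (ξ n i ω)‖ ^ 2) / n with hW
  have hmθ : Measurable fun u => ‖θ u - s u‖ ^ 2 := (hθm.sub s.measurable).norm.pow_const 2
  have hWi : ∀ n i, Measurable fun ω => ‖θ (ξ n i ω) - s (ξ n i ω)‖ ^ 2 := fun n i =>
    hmθ.comp ((hG n).measurable_latent i)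
  have hWm : ∀ n, Measurable (W n) := fun n =>
    (Finset.measurable_sum _ fun i _ => hWi n i).div_const _
  have hWle : ∀ n, ∫⁻ ω, ENNReal.ofReal (W n ω) ∂μ n ≤ ENNReal.ofReal η := fun n =>
    lintegral_average_le (hWi n) (fun i ω => sq_nonneg _) fun i => by
      rw [(hG n).lintegral_latent (f := fun u => ENNReal.ofReal (‖θ u - s u‖ ^ 2))
        hmθ.ennreal_ofReal i]
      exact hs
  filter_upwards [eventually_gt_atTop 0, (ENNReal.tendsto_nhds_zero.1 (hV (e / 8) (by positivity)))
    (ζ / 2) (ENNReal.half_pos hζ.ne')] with n hn hVn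
  have hWn : μ n {ω | ENNReal.ofReal (e / 16) ≤ ENNReal.ofReal (W n ω)} ≤ ζ / 2 :=
    (meas_ge_le_lintegral_div (hWm n).ennreal_ofReal.aemeasurable (by simp [he0])
      ENNReal.ofReal_ne_top).trans ((ENNReal.div_le_div_right (hWle n) _).trans hηζ)
  refine (measure_mono fun ω hω => ?_).trans ((measure_union_le _ _).trans
    ((add_le_add hVn hWn).trans (ENNReal.add_halves ζ).le))
  have hmal := le_trans hω (mallows_empirical_le hn (x n ω) (fun i => ξ n i ω) hθm s hB hη0.le hs)
  have hsq := pow_le_pow_left' hmal 2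
  rw [← ENNReal.rpow_natCast (_ ^ (1 / 2 : ℝ)) 2, ← ENNReal.rpow_mul] at hsq
  rw [show ((1 / 2 : ℝ) * ((2 : ℕ) : ℝ)) = 1 by norm_num, ENNReal.rpow_one] at hsq
  have hlt := (ENNReal.ofReal_le_ofReal_iff'.1 (he.trans hsq)).resolve_right (not_le.2 he0)
  simp only [Set.mem_union, Set.mem_ofPred_eq]
  by_contra! hcon
  obtain ⟨hc1, hc2⟩ := hcon
  have hc3 : W n ω < e / 16 := (ENNReal.ofReal_lt_ofReal_iff (by positivity)).1 hc2
  simp only [hW] at hc3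
  linarith

end Mallows

/-! ### Regularity of `θ_m` and the theorem -/

section Main

variable {w : I → I → ℝ} {m : ℕ}

lemma measurable_theta (hw : Measurable (Function.uncurry w)) (hw0 : ∀ u v, 0 ≤ w u v)
    (hsymm : ∀ u v, w u v = w v u)
    (hfin : momentBound volume (fun u v => ENNReal.ofReal (w u v)) m ≠ ∞) :
    Measurable (theta m w) := by
  have h : theta m w = fun u => WithLp.toLp 2 fun k : Fin m => pathMean w (k + 1) u := by
    funext u
    ext k
    exact theta_apply hw hw0 hsymm hfin u k
  rw [h]
  exact (WithLp.measurable_toLp 2 _).comp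
    (measurable_pi_lambda _ fun k => measurable_pathMean hw _)

lemma memLp_theta (hw : Measurable (Function.uncurry w)) (hw0 : ∀ u v, 0 ≤ w u v)
    (hsymm : ∀ u v, w u v = w v u)
    (hfin : momentBound volume (fun u v => ENNReal.ofReal (w u v)) m ≠ ∞) :
    MemLp (theta m w) 2 (volume : Measure I) := by
  rw [memLp_two_iff_integrable_sq_norm
    (measurable_theta hw hw0 hsymm hfin).aestronglyMeasurable]
  simp_rw [EuclideanSpace.real_norm_sq_eq, theta_apply hw hw0 hsymm hfin]
  exact integrable_finsetSum _ fun k _ =>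
    (memLp_pathMean hw hsymm (Nat.succ_ne_zero _) k.isLt hfin).integrable_sq

end Main

end LatentGraph

open LatentGraph in
theorem theorem5 (m : ℕ) (hm : 1 ≤ m)
    (w : I → I → ℝ)
    (hw_meas : Measurable (Function.uncurry w))
    (hw_nonneg : ∀ u v, 0 ≤ w u v)
    (hw_symm : ∀ u v, w u v = w v u)
    (hw_one : ∫ p : I × I, w p.1 p.2 = 1)
    (hw_moment : Integrable fun p : I × I => w p.1 p.2 ^ (2 * m))
    (ρ : ℕ → ℝ) (hρ_pos : ∀ n, 0 < ρ n)
    (hρ_trunc : Tendsto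
      (fun n => eLpNorm (fun p : I × I => truncKernel w (ρ n) p.1 p.2 - w p.1 p.2) 2 volume)
      atTop (𝓝 0))
    (hρ_degree : Tendsto (fun n : ℕ => ((n : ℝ) - 1) * ρ n) atTop atTop)
    (Ω : ℕ → Type*) [∀ n, MeasurableSpace (Ω n)]
    (μ : ∀ n, Measure (Ω n)) [∀ n, IsProbabilityMeasure (μ n)]
    (ξ : ∀ n, Fin n → Ω n → I) (G : ∀ n, Ω n → SimpleGraph (Fin n))
    (hG : ∀ n, IsLatentGraph (μ n) (edgeProb w (ρ n)) (ξ n) (G n)) :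
    (∀ ε : ℝ≥0∞, 0 < ε → Tendsto
      (fun n => μ n {ω | ε ≤ mallows (empirical fun i => degreeVec m (G n ω) i)
        (Measure.map (theta m w) (volume : Measure I))})
      atTop (𝓝 0)) ∧
    (∀ ε : ℝ, 0 < ε → Tendsto
      (fun n => μ n {ω | ε ≤ ∫ z, ‖z.1 - z.2‖ ^ 2
        ∂(empirical fun i => (degreeVec m (G n ω) i, theta m w (ξ n i ω)))})
      atTop (𝓝 0)) := by
  have hfin := momentBound_ne_top hw_meas hw_nonneg hw_moment
  have hmain := vanish_average_degreeVec_sub_theta hm hw_meas hw_nonneg hw_symm hw_one hfin hρ_pos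
    hρ_trunc hρ_degree hG
  refine ⟨tendsto_mallows_empirical hG (measurable_theta hw_meas hw_nonneg hw_symm hfin)
    (memLp_theta hw_meas hw_nonneg hw_symm hfin) hmain, fun ε hε => ?_⟩
  have hdist : Measurable fun z : EuclideanSpace ℝ (Fin m) × EuclideanSpace ℝ (Fin m) =>
      ‖z.1 - z.2‖ ^ 2 := (measurable_fst.sub measurable_snd).norm.pow_const 2
  simp_rw [integral_empirical _ hdist]
  exact hmain ε hε
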